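/- **Setting.** Let $d\ge 1$, $\ell>0$, and let $\mathbb T_\ell=\mathbb R^d/(\ell\mathbb Z)^d$ be the flat torus, of volume $|\mathbb T_\ell|=\ell^d$; functions on $\mathbb T_\ell$ are identified with periodic functions on $\mathbb R^d$. Write $⨍_{\mathbb T_\ell}=|\mathbb T_\ell|^{-1}\int_{\mathbb T_\ell}$, let $B_1\subset\mathbb R^d$ be the open unit ball, and let $\omega_{d-1}$ be the volume of the unit ball of $\mathbb R^{d-1}$ ($\omega_0=1$). $BV(\mathbb T_\ell;\{0,1\})$ is the set of $u\in L^1(\mathbb T_\ell)$ with $u\in\{0,1\}$ a.e. whose distributional gradient $\nabla u$ is a finite measure, i.e. whose total variation $$\|\nabla u\|=\int_{\mathbb T_\ell}|\nabla u|=\sup\Big\{\int_{\mathbb T_\ell}u\,\operatorname{div}\Phi\,dx:\ \Phi\in C^\infty(\mathbb T_\ell;\mathbb R^d),\ |\Phi|\le1\Big\}$$ is finite. For $\omega\in\mathbb R^d$, $\int_{\mathbb T_\ell}|\omega\cdot\nabla u|$ denotes the total variation of the measure $\omega\cdot\nabla u$, i.e. $\sup\{\int_{\mathbb T_\ell} u\,(\omega\cdot\nabla\varphi)\,dx:\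 \varphi\in C^\infty(\mathbb T_\ell),\ |\varphi|\le 1\}$. **Kernels.** Let $\epsilon_0>0$ and let $K_\epsilon:(0,\infty)\to[0,\infty)$, $\epsilon\in(0,\epsilon_0)$, and $K_0:(0,\infty)\to[0,\infty)$ be measurable, with $\int_0^1K_\epsilon(r)r^{d-1}\,dr<\infty$ for every $\epsilon\in(0,\epsilon_0)$ and $K_\epsilon\nearrow K_0$ as $\epsilon\searrow0$ (that is, for every $r>0$, $K_\epsilon(r)$ is non-increasing in $\epsilon$ and tends to $K_0(r)$ as $\epsilon\to0$). Assume $$\int_0^1K_0(r)\,r^{d-1}\,dr=\infty,\qquad \int_\delta^\infty K_0(r)\min\{r^{d-2},r^{d-1}\}\,dr<\infty\quad\text{for all }\delta>0.$$ **Energies.** Let $M_\epsilon=\omega_{d-1}\int_0^1K_\epsilon(t)t^{d-1}\,dt$. For $u\in BV(\mathbb T_\ell;\{0,1\})$ put $$\mathcal E_\epsilon(u)=M_\epsilon⨍_{\mathbb T_\ell}|\nabla u|-\int_{\mathbb R^d}K_\epsilon(|z|)⨍_{\mathbb T_\ell}\frac{|u(x+z)-u(x)|}{2|z|}\,dx\,dz,$$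 $$\mathcal E_0(u)=\frac12\int_{\mathbb R^d}⨍_{\mathbb T_\ell}K_0(|z|)\Big(\Big|\frac z{|z|}\cdot\nabla u(x)\Big|\chi_{B_1}(z)-\frac{|u(x+z)-u(x)|}{|z|}\Big)\,dx\,dz\in\mathbb R\cup\{+\infty\},$$ where in $\mathcal E_0$ the integral over $x$ is taken first; for all other $u\in L^1(\mathbb T_\ell)$ put $\mathcal E_\epsilon(u)=\mathcal E_0(u)=+\infty$. **Theorem 1.1.** 1. (Compactness) Let $\epsilon_j\in(0,\epsilon_0)$, $\epsilon_j\to0$, and $u_j\in BV(\mathbb T_\ell;\{0,1\})$ with $\sup_j\mathcal E_{\epsilon_j}(u_j)<\infty$. Then there are $u\in BV(\mathbb T_\ell;\{0,1\})$ and a subsequence (not relabelled) such that $u_j\to u$ in $L^1(\mathbb T_\ell)$ and $\int_{\mathbb T_\ell}|\nabla u_j|\to\int_{\mathbb T_\ell}|\nabla u|$. 2. ($\Gamma$-convergence) $\mathcal E_\epsilon\to\mathcal E_0$ as $\epsilon\to0$ in the sense of $\Gamma$-convergence in the $L^1(\mathbb T_\ell)$-topology. That is, for every sequence $\epsilon_j\in(0,\epsilon_0)$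 with $\epsilon_j\to0$ and every $u\in L^1(\mathbb T_\ell)$: (a) $\mathcal E_0(u)\le\liminf_{j}\mathcal E_{\epsilon_j}(u_j)$ for every sequence $u_j\to u$ in $L^1(\mathbb T_\ell)$; (b) there is a sequence $u_j\to u$ in $L^1(\mathbb T_\ell)$ with $\limsup_{j}\mathcal E_{\epsilon_j}(u_j)\le\mathcal E_0(u)$. -/

import Mathlib

open MeasureTheory Filter Topology Set
open scoped ENNReal NNReal

noncomputable section

namespace NonlocalPerimeter

/-- The flat torus `ℝ^d / (ℓ ℤ)^d`, with its Lebesgue measure `volume` (of total mass `ℓ ^ d`). -/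
abbrev Torus (d : ℕ) (ℓ : ℝ) : Type := Fin d → AddCircle ℓ

/-- Euclidean space `ℝ^d`. -/
abbrev E (d : ℕ) : Type := EuclideanSpace ℝ (Fin d)

variable {d : ℕ} {ℓ : ℝ}

/-- The canonical projection `ℝ^d → ℝ^d / (ℓ ℤ)^d`. -/
def proj (ℓ : ℝ) (z : E d) : Torus d ℓ := fun i => (z i : AddCircle ℓ)

/-- A function on the torus is smooth if its periodic lift to `ℝ^d` is `C^∞`. -/
def IsSmooth {F : Type*} [NormedAddCommGroup F] [NormedSpace ℝ F] (φ : Torus d ℓ → F) : Prop :=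
  ContDiff ℝ (⊤ : ℕ∞) (fun z : E d => φ (proj ℓ z))

/-- The directional derivative `ω · ∇φ` of a function on the torus. -/
def dirDeriv (ω : E d) (φ : Torus d ℓ → ℝ) (x : Torus d ℓ) : ℝ :=
  deriv (fun t : ℝ => φ (x + proj ℓ (t • ω))) 0

/-- The divergence of a vector field on the torus. -/
def divergence (Φ : Torus d ℓ → E d) (x : Torus d ℓ) : ℝ :=
  ∑ i : Fin d, dirDeriv (EuclideanSpace.single i (1 : ℝ)) (fun y => Φ y i) x

section Variation

variable [Fact (0 < ℓ)]

/-- The total variation `‖∇u‖ = |∇u|(𝕋_ℓ) = ∫ |∇u|` of the distributional gradient of `u`: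
the supremum of `∫ u div Φ` over smooth vector fields `Φ` with `|Φ| ≤ 1`. -/
def totalVariation (u : Torus d ℓ → ℝ) : ℝ≥0∞ :=
  ⨆ (Φ : Torus d ℓ → E d) (_ : IsSmooth Φ) (_ : ∀ x, ‖Φ x‖ ≤ 1),
    ENNReal.ofReal (∫ x, u x * divergence Φ x)

/-- The total variation `∫ |ω · ∇u|` of the (scalar) distributional derivative `ω · ∇u`:
the supremum of `∫ u (ω · ∇φ)` over smooth `φ` with `|φ| ≤ 1`.  When `∇u = σ |∇u|` is a
finite measure, this is `∫ |ω · σ| d|∇u|`. -/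
def dirVariation (ω : E d) (u : Torus d ℓ → ℝ) : ℝ≥0∞ :=
  ⨆ (φ : Torus d ℓ → ℝ) (_ : IsSmooth φ) (_ : ∀ x, |φ x| ≤ 1),
    ENNReal.ofReal (∫ x, u x * dirDeriv ω φ x)

/-- The space `L^1(𝕋_ℓ)`, with its norm topology. -/
abbrev L1 (d : ℕ) (ℓ : ℝ) [Fact (0 < ℓ)] : Type :=
  Lp ℝ 1 (volume : Measure (Torus d ℓ))

/-- `u ∈ BV(𝕋_ℓ; {0,1})`, for `u ∈ L^1(𝕋_ℓ)`. -/
def IsBV01 (u : L1 d ℓ) : Prop :=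
  (∀ᵐ x, u x = 0 ∨ u x = 1) ∧ totalVariation (u : Torus d ℓ → ℝ) < ∞

end Variation

/-- `M = ω_{d-1} ∫_0^1 K(t) t^{d-1} dt`, with `ω_{d-1}` the volume of the unit ball of
`ℝ^{d-1}` (so `ω_0 = 1`); used for `d ≥ 1` only. -/
def kernelMass (d : ℕ) (K : ℝ → ℝ≥0) : ℝ≥0∞ :=
  volume (Metric.ball (0 : E (d - 1)) 1) *
    ∫⁻ t in Ioo (0 : ℝ) 1, (K t : ℝ≥0∞) * ENNReal.ofReal (t ^ (d - 1))

/-- The integral, in the extended sense, of a real function whose positive and negative parts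
are not both of infinite integral: `∫ f⁺ - ∫ f⁻`. -/
def extIntegral {α : Type*} [MeasureSpace α] (f : α → ℝ) : EReal :=
  ((∫⁻ a, ENNReal.ofReal (f a) : ℝ≥0∞) : EReal) - ((∫⁻ a, ENNReal.ofReal (-f a) : ℝ≥0∞) : EReal)

section Energies

variable [Fact (0 < ℓ)]

/-- The nonlocal perimeter `∫_{ℝ^d} K(|z|) ⨍_{𝕋_ℓ} |u(x+z) - u(x)| / (2|z|) dx dz`. -/
def nonlocalPerimeter (K : ℝ → ℝ≥0) (u : Torus d ℓ → ℝ) : ℝ≥0∞ :=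
  ∫⁻ z : E d, (K ‖z‖ : ℝ≥0∞) * ⨍⁻ x, ‖u (x + proj ℓ z) - u x‖ₑ / (2 * ‖z‖ₑ)

open Classical in
/-- The energy `M ⨍ |∇u| - ∫_{ℝ^d} K(|z|) ⨍_{𝕋_ℓ} |u(x+z) - u(x)| / (2|z|) dx dz` with kernel `K`,
extended by `+∞` outside `BV(𝕋_ℓ; {0,1})`. -/
def energy (K : ℝ → ℝ≥0) (u : L1 d ℓ) : EReal :=
  if IsBV01 u then
    ((kernelMass d K * (totalVariation (u : Torus d ℓ → ℝ) / volume (univ : Set (Torus d ℓ))) :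
      ℝ≥0∞) : EReal) - (nonlocalPerimeter K (u : Torus d ℓ → ℝ) : EReal)
  else ⊤

/-- The integrand (in `z`) of the limit energy,
`(1/2) K(|z|) ( ⨍ |z/|z| · ∇u| χ_{B_1}(z) - ⨍ |u(x+z) - u(x)| / |z| dx )`. -/
def limitDensity (K : ℝ → ℝ≥0) (u : Torus d ℓ → ℝ) (z : E d) : ℝ :=
  (1 / 2) * (K ‖z‖ : ℝ) *
    ((Metric.ball (0 : E d) 1).indicator
        (fun z => (dirVariation (‖z‖⁻¹ • z) u).toReal / volume.real (univ : Set (Torus d ℓ))) z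
      - ⨍ x, |u (x + proj ℓ z) - u x| / ‖z‖)

open Classical in
/-- The limit energy
`(1/2) ∫_{ℝ^d} ⨍_{𝕋_ℓ} K(|z|) ( |z/|z| · ∇u(x)| χ_{B_1}(z) - |u(x+z) - u(x)| / |z| ) dx dz`,
extended by `+∞` outside `BV(𝕋_ℓ; {0,1})`. -/
def limitEnergy (K : ℝ → ℝ≥0) (u : L1 d ℓ) : EReal :=
  if IsBV01 u then extIntegral (limitDensity K (u : Torus d ℓ → ℝ)) else ⊤

end Energies

/-- `Γ`-convergence of a sequence of functionals on a (metrizable) topological space: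
the liminf inequality and the existence of recovery sequences. -/
def GammaConverges {X : Type*} [TopologicalSpace X] (F : ℕ → X → EReal) (F₀ : X → EReal) : Prop :=
  (∀ (u : X) (v : ℕ → X), Tendsto v atTop (𝓝 u) →
      F₀ u ≤ liminf (fun j => F j (v j)) atTop) ∧
  (∀ u : X, ∃ v : ℕ → X, Tendsto v atTop (𝓝 u) ∧
      limsup (fun j => F j (v j)) atTop ≤ F₀ u)

end NonlocalPerimeter

end

open NonlocalPerimeter

/-! The mean of $|\omega\cdot p|$ over the unit sphere is proportional to $|p|$, with the constant
that enters $M_\epsilon$ (`lintegral_sphere_abs_inner`). Hence the local term $M_\epsilon\int|\nabla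
u|$ equals $\frac12\int_{B_1}K_\epsilon(|z|)\int|\frac z{|z|}\cdot\nabla u|\,dz$
(`lintegral_radial_mul_dirVariation`), and it can be combined with the nonlocal term under one
integral in $z$. Both energies then become, up to a common scale, an inner energy over $B_1$ minus
an outer energy over its complement (`energy_eq`, `limitEnergy_eq`).

The inner integrand is nonnegative, since $\int|u(x+z)-u(x)|\,dx\le\int|z\cdot\nabla u|$
(`translationDist_le_dirVariation`). The outer energy is bounded, and continuous under $L^1$
convergence, because $u$ takes only the values 0 and 1 and $K_0$ has an integrable tail.

Compactness: on an annulus $\delta<|z|<1$ the difference quotients are bounded, so the kernel mass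
$m_\delta$ of the annulus times the total variation is at most the inner energy plus a constant.
This bounds the perimeters, and $BV$ compactness gives an $L^1$ limit $u$. If the perimeters tend to
$P$, passing to the limit on the annulus gives $m_\delta(P-\|\nabla u\|)\le C$ with $C$ independent
of $\delta$. Since $m_\delta\to\infty$ as $\delta\to0$, no perimeter is lost
(`limit_totalVariation_le`).

The liminf inequality is Fatou's lemma in $z$: directional variations are lower semicontinuous in
$L^1$ and difference quotients are continuous. Compactness reduces general sequences to $BV$ ones.
For the limsup inequality the constant sequence works, because $K_\epsilon\le K_0$ makes the inner
energies at most the limiting one.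

All facts about variations are proved for smooth functions and transferred by mollification:
convolution with a probability measure increases no translation invariant variation, and variations
are lower semicontinuous (`exists_smooth_approx`). The structure of the measure $\nabla u$ is never
used. -/

noncomputable section

namespace NonlocalPerimeter

/-! ### Calculus and integration by parts on the torus -/

section Basic

variable {d : ℕ} {ℓ : ℝ}

theorem proj_add (z w : E d) : proj ℓ (z + w) = proj ℓ z + proj ℓ w := by
  ext i; simp [proj]

theorem proj_neg (z : E d) : proj ℓ (-z) = -proj ℓ z := by
  ext i; simp [proj]

theorem proj_sub (z w : E d) : proj ℓ (z - w) = proj ℓ z - proj ℓ w := by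
  ext i; simp [proj]

@[simp] theorem proj_zero : proj ℓ (0 : E d) = 0 := by
  ext i; simp [proj]

theorem isOpenQuotientMap_proj : IsOpenQuotientMap (proj (d := d) ℓ) := by
  have h1 : IsOpenQuotientMap (fun (z : Fin d → ℝ) (i : Fin d) => ((z i : ℝ) : AddCircle ℓ)) :=
    IsOpenQuotientMap.piMap fun _ => QuotientAddGroup.isOpenQuotientMap_mk
  exact h1.comp (PiLp.homeomorph 2 (fun _ : Fin d => ℝ)).isOpenQuotientMap

theorem continuous_proj : Continuous (proj (d := d) ℓ) := isOpenQuotientMap_proj.continuous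

theorem proj_surjective : Function.Surjective (proj (d := d) ℓ) := isOpenQuotientMap_proj.surjective

theorem measurable_proj : Measurable (proj (d := d) ℓ) := by
  refine measurable_pi_lambda _ fun i => ?_
  exact AddCircle.measurable_mk'.comp (by fun_prop)

section Smooth

variable {F : Type*} [NormedAddCommGroup F] [NormedSpace ℝ F]

theorem IsSmooth.continuous {φ : Torus d ℓ → F} (h : IsSmooth φ) : Continuous φ :=
  isOpenQuotientMap_proj.isQuotientMap.continuous_iff.2 (ContDiff.continuous h)

theorem IsSmooth.comp_add_right {φ : Torus d ℓ → F} (h : IsSmooth φ) (a : Torus d ℓ) :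
    IsSmooth fun x => φ (x + a) := by
  obtain ⟨b, rfl⟩ := proj_surjective a
  unfold IsSmooth at *
  simp_rw [← proj_add]
  exact h.comp (contDiff_id.add contDiff_const)

theorem IsSmooth.hasDerivAt {φ : Torus d ℓ → ℝ} (h : IsSmooth φ) (ω y : E d) (t : ℝ) :
    HasDerivAt (fun t : ℝ => φ (proj ℓ (y + t • ω)))
      (fderiv ℝ (fun z : E d => φ (proj ℓ z)) (y + t • ω) ω) t := by
  have h1 : HasFDerivAt (fun z : E d => φ (proj ℓ z)) _ (y + t • ω) :=
    ((ContDiff.differentiable h (by simp)) _).hasFDerivAt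
  have h2 : HasDerivAt (fun t : ℝ => y + t • ω) ω t := by
    simpa using ((hasDerivAt_id t).smul_const ω).const_add y
  exact h1.comp_hasDerivAt t h2

theorem IsSmooth.dirDeriv_proj {φ : Torus d ℓ → ℝ} (h : IsSmooth φ) (ω y : E d) :
    dirDeriv ω φ (proj ℓ y) = fderiv ℝ (fun z : E d => φ (proj ℓ z)) y ω := by
  have := (h.hasDerivAt ω y 0).deriv
  simpa [dirDeriv, proj_add] using this

theorem IsSmooth.dirDeriv {φ : Torus d ℓ → ℝ} (h : IsSmooth φ) (ω : E d) :
    IsSmooth (dirDeriv ω φ) := by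
  have : (fun z : E d => NonlocalPerimeter.dirDeriv ω φ (proj ℓ z))
      = fun z => fderiv ℝ (fun z : E d => φ (proj ℓ z)) z ω := by
    ext z; exact h.dirDeriv_proj ω z
  unfold IsSmooth
  rw [this]
  exact (ContDiff.fderiv_right h (m := (⊤ : ℕ∞)) (by simp)).clm_apply contDiff_const

theorem IsSmooth.hasDerivAt_dirDeriv {φ : Torus d ℓ → ℝ} (h : IsSmooth φ) (ω : E d)
    (x : Torus d ℓ) (t : ℝ) :
    HasDerivAt (fun t : ℝ => φ (x + proj ℓ (t • ω)))
      (NonlocalPerimeter.dirDeriv ω φ (x + proj ℓ (t • ω))) t := by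
  obtain ⟨y, rfl⟩ := proj_surjective x
  simp_rw [← proj_add, h.dirDeriv_proj]
  exact h.hasDerivAt ω y t

theorem dirDeriv_comp_add_right (ω : E d) (φ : Torus d ℓ → ℝ) (a x : Torus d ℓ) :
    dirDeriv ω (fun y => φ (y + a)) x = dirDeriv ω φ (x + a) := by
  simp only [dirDeriv, add_right_comm _ _ a]

theorem IsSmooth.dirDeriv_smul {φ : Torus d ℓ → ℝ} (h : IsSmooth φ) (c : ℝ) (ω : E d)
    (x : Torus d ℓ) :
    NonlocalPerimeter.dirDeriv (c • ω) φ x = c * NonlocalPerimeter.dirDeriv ω φ x := by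
  obtain ⟨y, rfl⟩ := proj_surjective x
  simp [h.dirDeriv_proj]

theorem IsSmooth.dirDeriv_eq_sum {φ : Torus d ℓ → ℝ} (h : IsSmooth φ) (ω : E d)
    (x : Torus d ℓ) :
    NonlocalPerimeter.dirDeriv ω φ x
      = ∑ i, ω i * NonlocalPerimeter.dirDeriv (EuclideanSpace.single i (1 : ℝ)) φ x := by
  obtain ⟨y, rfl⟩ := proj_surjective x
  simp only [h.dirDeriv_proj]
  conv_lhs => rw [← (EuclideanSpace.basisFun (Fin d) ℝ).sum_repr ω]
  simp [map_sum]

theorem IsSmooth.mul {φ ψ : Torus d ℓ → ℝ} (h : IsSmooth φ) (h' : IsSmooth ψ) :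
    IsSmooth fun x => φ x * ψ x :=
  ContDiff.mul h h'

theorem dirDeriv_mul {φ ψ : Torus d ℓ → ℝ} (h : IsSmooth φ) (h' : IsSmooth ψ) (ω : E d)
    (x : Torus d ℓ) :
    dirDeriv ω (fun x => φ x * ψ x) x = dirDeriv ω φ x * ψ x + φ x * dirDeriv ω ψ x := by
  have h1 := h.hasDerivAt_dirDeriv ω x 0
  have h2 := h'.hasDerivAt_dirDeriv ω x 0
  simp only [zero_smul, proj_zero, add_zero] at h1 h2
  simpa [dirDeriv] using (h1.fun_mul h2).deriv

theorem IsSmooth.apply {Φ : Torus d ℓ → E d} (h : IsSmooth Φ) (i : Fin d) :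
    IsSmooth fun x => Φ x i :=
  contDiff_piLp_apply (n := (⊤ : ℕ∞)) (i := i) (p := 2) |>.comp h

theorem continuous_divergence {Φ : Torus d ℓ → E d} (h : IsSmooth Φ) :
    Continuous (divergence Φ) :=
  continuous_finsetSum _ fun i _ => ((h.apply i).dirDeriv _).continuous

end Smooth

section Haar

variable [Fact (0 < ℓ)]

theorem exists_bound_of_continuous {F : Type*} [NormedAddCommGroup F] {f : Torus d ℓ → F}
    (h : Continuous f) : ∃ C, ∀ x, ‖f x‖ ≤ C := by
  obtain ⟨C, hC⟩ := isCompact_univ.exists_bound_of_continuousOn h.continuousOn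
  exact ⟨C, fun x => hC x (mem_univ x)⟩

theorem integrable_of_continuous {F : Type*} [NormedAddCommGroup F] {f : Torus d ℓ → F}
    (h : Continuous f) : Integrable f :=
  h.integrable_of_hasCompactSupport (HasCompactSupport.of_compactSpace f)

/-- The integral of a derivative over the torus vanishes. -/
theorem integral_dirDeriv {φ : Torus d ℓ → ℝ} (h : IsSmooth φ) (ω : E d) :
    ∫ x, dirDeriv ω φ x = 0 := by
  have hc : Continuous (dirDeriv ω φ) := (h.dirDeriv ω).continuous
  have hpc : Continuous fun t : ℝ => proj ℓ (t • ω) := continuous_proj.comp (by fun_prop)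
  -- Averaging the derivative over the segment from $x$ to $x+\omega$ gives an increment of `φ`,
  -- whose integral vanishes by translation invariance. By Fubini and the same invariance, the
  -- averaging does not change the integral.
  have h1 : ∀ x, ∫ t in (0 : ℝ)..1, dirDeriv ω φ (x + proj ℓ (t • ω)) = φ (x + proj ℓ ω) - φ x := by
    intro x
    rw [intervalIntegral.integral_eq_sub_of_hasDerivAt
      (fun t _ => h.hasDerivAt_dirDeriv ω x t)]
    · simp
    · exact (hc.comp (by fun_prop)).intervalIntegrable _ _
  have h2 : ∫ x, (∫ t in (0 : ℝ)..1, dirDeriv ω φ (x + proj ℓ (t • ω))) = 0 := by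
    simp_rw [h1]
    rw [integral_sub (integrable_of_continuous (h.comp_add_right _).continuous)
      (integrable_of_continuous h.continuous), integral_add_right_eq_self, sub_self]
  obtain ⟨C, hC⟩ := exists_bound_of_continuous hc
  have h3 : ∫ x, (∫ t in (0 : ℝ)..1, dirDeriv ω φ (x + proj ℓ (t • ω)))
      = ∫ t in (0 : ℝ)..1, ∫ x, dirDeriv ω φ (x + proj ℓ (t • ω)) := by
    simp_rw [intervalIntegral.integral_of_le zero_le_one]
    rw [integral_integral_swap]
    refine Integrable.of_bound (C := C) ?_ (ae_of_all _ fun x => hC _)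
    exact (hc.comp (continuous_fst.add (hpc.comp continuous_snd))).aestronglyMeasurable
  rw [h3] at h2
  simpa [integral_add_right_eq_self] using h2

theorem integral_mul_dirDeriv {φ ψ : Torus d ℓ → ℝ} (h : IsSmooth φ) (h' : IsSmooth ψ)
    (ω : E d) : ∫ x, φ x * dirDeriv ω ψ x = -∫ x, dirDeriv ω φ x * ψ x := by
  have := integral_dirDeriv (h.mul h') ω
  simp_rw [dirDeriv_mul h h'] at this
  have c1 := h.continuous
  have c2 := h'.continuous
  have c3 := (h.dirDeriv ω).continuous
  have c4 := (h'.dirDeriv ω).continuous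
  rw [integral_add (f := fun x => dirDeriv ω φ x * ψ x) (g := fun x => φ x * dirDeriv ω ψ x)
    (integrable_of_continuous (c3.mul c2)) (integrable_of_continuous (c1.mul c4))] at this
  linarith

end Haar

end Basic

/-! ### Variations as suprema over translation invariant test families; mollification -/

section TestFamily

variable {d : ℕ} {ℓ : ℝ}

/-- A family of continuous test functions that is invariant under translations. -/
structure IsTestFamily (S : Set (Torus d ℓ → ℝ)) : Prop where
  continuous : ∀ ψ ∈ S, Continuous ψ
  translate : ∀ ψ ∈ S, ∀ a, (fun x => ψ (x + a)) ∈ S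

/-- The test functions `ω · ∇φ` in the definition of `dirVariation`. -/
def dirTests (ℓ : ℝ) (ω : E d) : Set (Torus d ℓ → ℝ) :=
  {ψ | ∃ φ, IsSmooth φ ∧ (∀ x, |φ x| ≤ 1) ∧ dirDeriv ω φ = ψ}

/-- The test functions `div Φ` in the definition of `totalVariation`. -/
def divTests (d : ℕ) (ℓ : ℝ) : Set (Torus d ℓ → ℝ) :=
  {ψ | ∃ Φ : Torus d ℓ → E d, IsSmooth Φ ∧ (∀ x, ‖Φ x‖ ≤ 1) ∧ divergence Φ = ψ}

theorem isTestFamily_dirTests (ω : E d) : IsTestFamily (dirTests ℓ ω) where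
  continuous := by
    rintro _ ⟨φ, h, -, rfl⟩
    exact (h.dirDeriv ω).continuous
  translate := by
    rintro _ ⟨φ, h, h', rfl⟩ a
    exact ⟨fun x => φ (x + a), h.comp_add_right a, fun x => h' _,
      funext fun x => dirDeriv_comp_add_right ω φ a x⟩

theorem isTestFamily_divTests : IsTestFamily (divTests d ℓ) where
  continuous := by
    rintro _ ⟨φ, h, -, rfl⟩
    exact continuous_divergence h
  translate := by
    rintro _ ⟨Φ, h, h', rfl⟩ a
    refine ⟨fun x => Φ (x + a), h.comp_add_right a, fun x => h' _, funext fun x => ?_⟩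
    exact Finset.sum_congr rfl fun i _ => dirDeriv_comp_add_right _ (fun y => Φ y i) a x

section Haar

variable [Fact (0 < ℓ)]

/-- The supremum of the pairings of `u` with the test functions in `S`. -/
def testSup (S : Set (Torus d ℓ → ℝ)) (u : Torus d ℓ → ℝ) : ℝ≥0∞ :=
  ⨆ ψ ∈ S, ENNReal.ofReal (∫ x, u x * ψ x)

theorem dirVariation_eq_testSup (ω : E d) (u : Torus d ℓ → ℝ) :
    dirVariation ω u = testSup (dirTests ℓ ω) u := by
  apply le_antisymm
  · refine iSup_le fun φ => iSup_le fun h => iSup_le fun h' => ?_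
    exact le_iSup₂ (f := fun ψ (_ : ψ ∈ dirTests ℓ ω) => ENNReal.ofReal (∫ x, u x * ψ x))
      (dirDeriv ω φ) ⟨φ, h, h', rfl⟩
  · refine iSup₂_le ?_
    rintro _ ⟨φ, h, h', rfl⟩
    exact le_iSup_of_le φ (le_iSup_of_le h (le_iSup_of_le h' le_rfl))

theorem totalVariation_eq_testSup (u : Torus d ℓ → ℝ) :
    totalVariation u = testSup (divTests d ℓ) u := by
  apply le_antisymm
  · refine iSup_le fun Φ => iSup_le fun h => iSup_le fun h' => ?_
    exact le_iSup₂ (f := fun ψ (_ : ψ ∈ divTests d ℓ) => ENNReal.ofReal (∫ x, u x * ψ x))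
      (divergence Φ) ⟨Φ, h, h', rfl⟩
  · refine iSup₂_le ?_
    rintro _ ⟨Φ, h, h', rfl⟩
    exact le_iSup_of_le Φ (le_iSup_of_le h (le_iSup_of_le h' le_rfl))

theorem testSup_congr {S : Set (Torus d ℓ → ℝ)} {u v : Torus d ℓ → ℝ} (h : u =ᵐ[volume] v) :
    testSup S u = testSup S v := by
  refine iSup_congr fun ψ => iSup_congr fun _ => congrArg ENNReal.ofReal (integral_congr_ae ?_)
  filter_upwards [h] with x hx
  rw [hx]

theorem dirVariation_congr {u v : Torus d ℓ → ℝ} (h : u =ᵐ[volume] v) (ω : E d) :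
    dirVariation ω u = dirVariation ω v := by
  simp_rw [dirVariation_eq_testSup, testSup_congr h]

theorem totalVariation_congr {u v : Torus d ℓ → ℝ} (h : u =ᵐ[volume] v) :
    totalVariation u = totalVariation v := by
  simp_rw [totalVariation_eq_testSup, testSup_congr h]

/-- Suprema of pairings with continuous functions are lower semicontinuous in `L¹`. -/
theorem IsTestFamily.testSup_le_liminf {S : Set (Torus d ℓ → ℝ)} (hS : IsTestFamily S)
    {ι : Type*} {l : Filter ι} [l.NeBot] {u : Torus d ℓ → ℝ} {v : ι → Torus d ℓ → ℝ}
    (hu : Integrable u) (hv : ∀ i, Integrable (v i))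
    (hlim : Tendsto (fun i => ∫⁻ x, ‖v i x - u x‖ₑ) l (𝓝 0)) :
    testSup S u ≤ liminf (fun i => testSup S (v i)) l := by
  refine iSup₂_le fun ψ hψ => ?_
  have hc := hS.continuous ψ hψ
  obtain ⟨C, hC⟩ := exists_bound_of_continuous hc
  have hm : AEStronglyMeasurable ψ (volume : Measure (Torus d ℓ)) := hc.aestronglyMeasurable
  have hint : ∀ w : Torus d ℓ → ℝ, Integrable w → Integrable fun x => w x * ψ x :=
    fun w hw => hw.mul_bdd hm (ae_of_all _ hC)
  have h1 : Tendsto (fun i => ∫ x, v i x * ψ x) l (𝓝 (∫ x, u x * ψ x)) := by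
    refine tendsto_integral_of_L1 _ (hint u hu).1 (Eventually.of_forall fun i => hint _ (hv i)) ?_
    have h2 : Tendsto (fun i => (∫⁻ x, ‖v i x - u x‖ₑ) * ENNReal.ofReal C) l (𝓝 0) := by
      simpa using ENNReal.Tendsto.mul_const hlim (Or.inr ENNReal.ofReal_ne_top)
    refine tendsto_of_tendsto_of_tendsto_of_le_of_le tendsto_const_nhds h2
      (fun _ => zero_le) fun i => ?_
    dsimp only
    rw [← lintegral_mul_const' _ _ ENNReal.ofReal_ne_top]
    refine lintegral_mono fun x => ?_
    rw [← sub_mul, enorm_mul]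
    gcongr
    rw [← ofReal_norm]
    exact ENNReal.ofReal_le_ofReal (hC x)
  rw [← ((ENNReal.continuous_ofReal.tendsto _).comp h1).liminf_eq]
  refine liminf_le_liminf (Eventually.of_forall fun i => ?_)
  exact le_iSup₂ (f := fun ψ (_ : ψ ∈ S) => ENNReal.ofReal (∫ x, v i x * ψ x)) ψ hψ

/-- A measurable function with values in `[-1, 1]`. -/
structure UnitBounded (u : Torus d ℓ → ℝ) : Prop where
  measurable : Measurable u
  abs_le : ∀ x, |u x| ≤ 1

theorem UnitBounded.integrable {u : Torus d ℓ → ℝ} (h : UnitBounded u) : Integrable u :=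
  Integrable.of_bound (C := 1) h.measurable.aestronglyMeasurable (ae_of_all _ h.abs_le)

/-- The `L¹` distance between `u` and its translate by `a`. -/
def translationDist (u : Torus d ℓ → ℝ) (a : Torus d ℓ) : ℝ≥0∞ :=
  ∫⁻ x, ‖u (x + a) - u x‖ₑ

theorem measurable_translationDist {u : Torus d ℓ → ℝ} (h : Measurable u) :
    Measurable (translationDist u) := by
  refine Measurable.lintegral_prod_right' (f := fun p : Torus d ℓ × Torus d ℓ =>
    ‖u (p.2 + p.1) - u p.2‖ₑ) ?_
  exact ((h.comp (measurable_snd.add measurable_fst)).sub (h.comp measurable_snd)).enorm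

theorem tendsto_translationDist {u : Torus d ℓ → ℝ} (h : Integrable u) :
    Tendsto (translationDist u) (𝓝 0) (𝓝 0) := by
  have hu : MemLp u 1 (volume : Measure (Torus d ℓ)) := memLp_one_iff_integrable.2 h
  have : Fact ((1 : ℝ≥0∞) ≠ ∞) := ⟨ENNReal.one_ne_top⟩
  have h1 : Continuous fun a : Torus d ℓ => (DomAddAct.mk a) +ᵥ hu.toLp u :=
    (Lp.instContinuousVAddDomAddAct (X := Torus d ℓ) (M := Torus d ℓ) (E := ℝ) (μ := volume)
      (p := 1)).continuous_vadd.comp (DomAddAct.continuous_mk.prodMk continuous_const)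
  have h2 := (h1.tendsto 0).edist (tendsto_const_nhds (x := hu.toLp u))
  have h3 : ∀ a : Torus d ℓ, edist (DomAddAct.mk a +ᵥ hu.toLp u) (hu.toLp u)
      = translationDist u a := by
    intro a
    rw [DomAddAct.mk_vadd_toLp, Lp.edist_toLp_toLp, eLpNorm_one_eq_lintegral_enorm]
    simp [translationDist, add_comm]
  simp_rw [h3] at h2
  have h4 : translationDist u 0 = 0 := by simp [translationDist]
  rwa [h4] at h2

/-- The convolution of `u` with a measure on the torus. -/
def mollify (μ : Measure (Torus d ℓ)) (u : Torus d ℓ → ℝ) (x : Torus d ℓ) : ℝ :=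
  ∫ a, u (x - a) ∂μ

section Mollify

variable {μ : Measure (Torus d ℓ)} [IsProbabilityMeasure μ] {u : Torus d ℓ → ℝ}

theorem UnitBounded.mollify (h : UnitBounded u) : UnitBounded (mollify μ u) where
  measurable := by
    refine (StronglyMeasurable.integral_prod_right' (ν := μ)
      (f := fun p : Torus d ℓ × Torus d ℓ => u (p.1 - p.2)) ?_).measurable
    exact (h.measurable.comp (measurable_fst.sub measurable_snd)).stronglyMeasurable
  abs_le x := by
    have := norm_integral_le_of_norm_le_const (μ := μ) (f := fun a => u (x - a)) (C := 1)
      (ae_of_all _ fun a => h.abs_le _)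
    simpa [NonlocalPerimeter.mollify] using this

/-- Since `μ` has mass one, the error at `x` is the `μ`-average of $u(x-a)-u(x)$; Tonelli gives the
bound. -/
theorem lintegral_mollify_sub_le (h : UnitBounded u) :
    ∫⁻ x, ‖mollify μ u x - u x‖ₑ ≤ ∫⁻ a, translationDist u (-a) ∂μ := by
  have hm : Measurable fun p : Torus d ℓ × Torus d ℓ => ‖u (p.1 - p.2) - u p.1‖ₑ :=
    ((h.measurable.comp (measurable_fst.sub measurable_snd)).sub
      (h.measurable.comp measurable_fst)).enorm
  have h1 : ∀ x, ‖NonlocalPerimeter.mollify μ u x - u x‖ₑ ≤ ∫⁻ a, ‖u (x - a) - u x‖ₑ ∂μ := by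
    intro x
    have hi : Integrable (fun a => u (x - a)) μ :=
      Integrable.of_bound (C := 1)
        (h.measurable.comp (measurable_const.sub measurable_id)).aestronglyMeasurable
        (ae_of_all _ fun a => h.abs_le _)
    have : NonlocalPerimeter.mollify μ u x - u x = ∫ a, (u (x - a) - u x) ∂μ := by
      rw [integral_sub hi (integrable_const _)]
      simp [NonlocalPerimeter.mollify]
    rw [this]
    exact enorm_integral_le_lintegral_enorm _
  refine (lintegral_mono h1).trans ?_
  rw [lintegral_lintegral_swap hm.aemeasurable]
  simp [translationDist, sub_eq_add_neg]

/-- Fubini moves the convolution onto the test function. The integrability is recorded because the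
pairings are later compared under the integral over `μ`. -/
theorem integral_mollify_mul (h : UnitBounded u) {ψ : Torus d ℓ → ℝ} (hψ : Continuous ψ) :
    Integrable (fun a => ∫ x, u x * ψ (x + a)) μ ∧
      ∫ x, mollify μ u x * ψ x = ∫ a, (∫ x, u x * ψ (x + a)) ∂μ := by
  obtain ⟨C, hC⟩ := exists_bound_of_continuous hψ
  have hi : Integrable (fun p : Torus d ℓ × Torus d ℓ => u (p.1 - p.2) * ψ p.1)
      (volume.prod μ) := by
    refine Integrable.of_bound (C := 1 * C) ?_ (ae_of_all _ fun p => ?_)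
    · exact ((h.measurable.comp (measurable_fst.sub measurable_snd)).mul
        (hψ.measurable.comp measurable_fst)).aestronglyMeasurable
    · rw [norm_mul]
      exact mul_le_mul (h.abs_le _) (hC _) (norm_nonneg _) zero_le_one
  have h1 : ∀ a, ∫ x, u (x - a) * ψ x = ∫ x, u x * ψ (x + a) := by
    intro a
    rw [← integral_add_right_eq_self _ a]
    simp
  constructor
  · have := hi.integral_prod_right
    simpa only [h1] using this
  · simp_rw [NonlocalPerimeter.mollify, ← integral_mul_const]
    rw [integral_integral_swap hi]
    simp_rw [h1]

/-- The pairing of the mollification with `ψ` is an average of pairings of `u` with translates of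
`ψ`, and these all belong to `S`. -/
theorem IsTestFamily.testSup_mollify_le {S : Set (Torus d ℓ → ℝ)} (hS : IsTestFamily S)
    (h : UnitBounded u) : testSup S (NonlocalPerimeter.mollify μ u) ≤ testSup S u := by
  refine iSup₂_le fun ψ hψ => ?_
  by_cases ht : testSup S u = ∞
  · simp [ht]
  obtain ⟨hi, he⟩ := integral_mollify_mul (μ := μ) h (hS.continuous ψ hψ)
  rw [he]
  refine ENNReal.ofReal_le_of_le_toReal ?_
  have h1 : ∀ a, ∫ x, u x * ψ (x + a) ≤ (testSup S u).toReal := by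
    intro a
    rw [← ENNReal.ofReal_le_iff_le_toReal ht]
    exact le_iSup₂ (f := fun ψ (_ : ψ ∈ S) => ENNReal.ofReal (∫ x, u x * ψ x)) _
      (hS.translate ψ hψ a)
  calc _ ≤ ∫ _, (testSup S u).toReal ∂μ := integral_mono hi (integrable_const _) h1
    _ = _ := by simp

end Mollify

end Haar

end TestFamily

/-! ### Smooth approximation and variations of smooth functions -/

section Smoothing

variable {d : ℕ} {ℓ : ℝ}

/-- The measure on the torus induced by a normalized bump function around the origin of `ℝ^d`. -/
def bumpMeasure (ℓ : ℝ) (ρ : ContDiffBump (0 : E d)) : Measure (Torus d ℓ) :=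
  ((volume : Measure (E d)).withDensity
    fun z => ENNReal.ofReal (ρ.normed volume z)).map (proj ℓ)

theorem measurable_normed (ρ : ContDiffBump (0 : E d)) :
    Measurable (ρ.normed (volume : Measure (E d))) :=
  ρ.continuous_normed.measurable

theorem lintegral_normed (ρ : ContDiffBump (0 : E d)) :
    ∫⁻ z : E d, ENNReal.ofReal (ρ.normed volume z) = 1 := by
  rw [← ofReal_integral_eq_lintegral_ofReal ρ.integrable_normed (ae_of_all _ ρ.nonneg_normed),
    ρ.integral_normed, ENNReal.ofReal_one]

instance (ρ : ContDiffBump (0 : E d)) : IsProbabilityMeasure (bumpMeasure ℓ ρ) := by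
  have : IsProbabilityMeasure ((volume : Measure (E d)).withDensity
      fun z => ENNReal.ofReal (ρ.normed volume z)) := ⟨by simpa using lintegral_normed ρ⟩
  exact Measure.isProbabilityMeasure_map measurable_proj.aemeasurable

theorem lintegral_bumpMeasure_le (ρ : ContDiffBump (0 : E d)) {f : Torus d ℓ → ℝ≥0∞}
    (hf : Measurable f) {C : ℝ≥0∞} (h : ∀ z : E d, ‖z‖ < ρ.rOut → f (proj ℓ z) ≤ C) :
    ∫⁻ a, f a ∂bumpMeasure ℓ ρ ≤ C := by
  rw [bumpMeasure, lintegral_map hf measurable_proj,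
    lintegral_withDensity_eq_lintegral_mul _ (measurable_normed ρ).ennreal_ofReal
      (show Measurable fun z => f (proj ℓ z) from hf.comp measurable_proj)]
  calc _ ≤ ∫⁻ z : E d, ENNReal.ofReal (ρ.normed volume z) * C := by
        refine lintegral_mono fun z => ?_
        simp only [Pi.mul_apply]
        by_cases hz : ‖z‖ < ρ.rOut
        · gcongr
          exact h z hz
        · have : ρ.normed volume z = 0 := by
            rw [← Function.notMem_support, ρ.support_normed_eq]
            simpa using hz
          simp [this]
    _ = C := by rw [lintegral_mul_const _ (measurable_normed ρ).ennreal_ofReal,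
      lintegral_normed, one_mul]

theorem mollify_bumpMeasure_apply (ρ : ContDiffBump (0 : E d)) {u : Torus d ℓ → ℝ}
    (h : Measurable u) (x : Torus d ℓ) :
    mollify (bumpMeasure ℓ ρ) u x = ∫ z, ρ.normed volume z * u (x - proj ℓ z) := by
  have hm : Measurable fun a => u (x - a) := h.comp (measurable_const.sub measurable_id)
  rw [mollify, bumpMeasure, integral_map measurable_proj.aemeasurable hm.aestronglyMeasurable,
    integral_withDensity_eq_integral_toReal_smul (measurable_normed ρ).ennreal_ofReal (by simp)]
  simp [ENNReal.toReal_ofReal (ρ.nonneg_normed _)]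

/-- Lifted to $\mathbb R^d$, the mollification is an ordinary convolution of a bounded periodic
function with a smooth compactly supported bump. -/
theorem isSmooth_mollify (ρ : ContDiffBump (0 : E d)) {u : Torus d ℓ → ℝ}
    (h : UnitBounded u) : IsSmooth (mollify (bumpMeasure ℓ ρ) u) := by
  have h1 : (fun y : E d => mollify (bumpMeasure ℓ ρ) u (proj ℓ y))
      = convolution (ρ.normed volume) (fun z => u (proj ℓ z)) (ContinuousLinearMap.mul ℝ ℝ)
        volume := by
    ext y
    simp [mollify_bumpMeasure_apply ρ h.measurable, convolution, proj_sub]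
  unfold IsSmooth
  rw [h1]
  refine HasCompactSupport.contDiff_convolution_left _ ρ.hasCompactSupport_normed
    ρ.contDiff_normed ?_
  refine (memLp_top_of_bound (C := 1) (h.measurable.comp measurable_proj).aestronglyMeasurable
    (ae_of_all _ fun z => h.abs_le _)).locallyIntegrable le_top

/-- The gradient of a smooth function on the torus. -/
def grad (f : Torus d ℓ → ℝ) (x : Torus d ℓ) : E d :=
  WithLp.toLp 2 fun i => dirDeriv (EuclideanSpace.single i (1 : ℝ)) f x

theorem IsSmooth.dirDeriv_eq_inner {f : Torus d ℓ → ℝ} (h : IsSmooth f) (ω : E d)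
    (x : Torus d ℓ) : NonlocalPerimeter.dirDeriv ω f x = inner ℝ ω (grad f x) := by
  rw [h.dirDeriv_eq_sum]
  simp [grad, PiLp.inner_apply, mul_comm]

theorem IsSmooth.grad {f : Torus d ℓ → ℝ} (h : IsSmooth f) :
    IsSmooth (NonlocalPerimeter.grad f) := by
  refine (contDiff_piLp 2).2 fun i => ?_
  exact h.dirDeriv _

section Smooth

variable [Fact (0 < ℓ)]

/-- Every bounded measurable function is an `L¹` limit of smooth functions that do not increase
any translation invariant variation. -/
theorem exists_smooth_approx {u : Torus d ℓ → ℝ} (h : UnitBounded u) :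
    ∃ v : ℕ → Torus d ℓ → ℝ, (∀ n, IsSmooth (v n)) ∧ (∀ n, UnitBounded (v n)) ∧
      (∀ n, ∀ S : Set (Torus d ℓ → ℝ), IsTestFamily S → testSup S (v n) ≤ testSup S u) ∧
      Tendsto (fun n => ∫⁻ x, ‖v n x - u x‖ₑ) atTop (𝓝 0) := by
  let ρ : ℕ → ContDiffBump (0 : E d) := fun n =>
    ⟨1 / 2 * (1 / (n + 1)), 1 / (n + 1), by positivity, by
      have : (0 : ℝ) < 1 / (n + 1) := by positivity
      linarith⟩
  refine ⟨fun n => mollify (bumpMeasure ℓ (ρ n)) u, fun n => isSmooth_mollify _ h,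
    fun n => h.mollify, fun n S hS => hS.testSup_mollify_le h, ?_⟩
  rw [ENNReal.tendsto_nhds_zero]
  intro η hη
  have h1 : Tendsto (fun z : E d => translationDist u (-proj ℓ z)) (𝓝 0) (𝓝 0) := by
    refine (tendsto_translationDist h.integrable).comp ?_
    have : Continuous fun z : E d => -proj ℓ z := continuous_proj.neg
    simpa using this.tendsto 0
  obtain ⟨r, hr, hr'⟩ := Metric.eventually_nhds_iff.1 (ENNReal.tendsto_nhds_zero.1 h1 η hη)
  obtain ⟨N, hN⟩ := exists_nat_one_div_lt hr
  filter_upwards [eventually_ge_atTop N] with n hn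
  refine (lintegral_mollify_sub_le h).trans (lintegral_bumpMeasure_le _
    ((measurable_translationDist h.measurable).comp measurable_neg) fun z hz => ?_)
  refine hr' ?_
  rw [dist_zero_right]
  have h2 : (1 : ℝ) / (n + 1) ≤ 1 / (N + 1) := by gcongr
  exact hz.trans (h2.trans_lt hN)

theorem integral_mul_divergence {f : Torus d ℓ → ℝ} (h : IsSmooth f) {Φ : Torus d ℓ → E d}
    (hΦ : IsSmooth Φ) :
    ∫ x, f x * divergence Φ x = -∫ x, (inner ℝ (grad f x) (Φ x) : ℝ) := by
  have hc := h.continuous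
  simp only [divergence, Finset.mul_sum, PiLp.inner_apply]
  have h1 : ∀ i ∈ (Finset.univ : Finset (Fin d)), Integrable fun x =>
      f x * dirDeriv (EuclideanSpace.single i 1) (fun y => Φ y i) x := fun i _ =>
    integrable_of_continuous (hc.mul ((hΦ.apply i).dirDeriv _).continuous)
  have h2 : ∀ i ∈ (Finset.univ : Finset (Fin d)), Integrable fun x =>
      (inner ℝ (grad f x i) (Φ x i) : ℝ) := fun i _ => by
    exact integrable_of_continuous ((h.grad.apply i).continuous.inner (hΦ.apply i).continuous)
  rw [integral_finsetSum _ h1, integral_finsetSum _ h2, ← Finset.sum_neg_distrib]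
  refine Finset.sum_congr rfl fun i _ => ?_
  rw [integral_mul_dirDeriv h (hΦ.apply i)]
  simp [grad, mul_comm]

theorem sub_le_sq_div_sqrt {a η : ℝ} (ha : 0 ≤ a) (hη : 0 < η) :
    a - η ≤ a ^ 2 / √(a ^ 2 + η ^ 2) := by
  have hs : 0 < √(a ^ 2 + η ^ 2) := Real.sqrt_pos.2 (by positivity)
  rw [le_div_iff₀ hs]
  have h1 : √(a ^ 2 + η ^ 2) ≤ a + η := by
    rw [Real.sqrt_le_left (by positivity)]
    nlinarith
  rcases le_total a η with h | h
  · nlinarith [sq_nonneg a]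
  · nlinarith [sq_nonneg η]

/-- The field $g/|g|$ that would realize $\int|g|$ is not smooth where $g$ vanishes. Replacing $|g|$
by $\sqrt{|g|^2+\eta^2}$ in the denominator costs at most `η` pointwise, and `η` tends to 0. -/
theorem lintegral_norm_le_of_regularized {F : Type*} [NormedAddCommGroup F] {g : Torus d ℓ → F}
    (hg : Continuous g) {W : ℝ≥0∞}
    (h : ∀ η : ℝ, 0 < η → ENNReal.ofReal (∫ x, ‖g x‖ ^ 2 / √(‖g x‖ ^ 2 + η ^ 2)) ≤ W) :
    ∫⁻ x, ‖g x‖ₑ ≤ W := by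
  have h0 : ∫⁻ x, ‖g x‖ₑ = ENNReal.ofReal (∫ x, ‖g x‖) := by
    rw [ofReal_integral_eq_lintegral_ofReal (integrable_of_continuous hg.norm)
      (ae_of_all _ fun x => norm_nonneg _)]
    simp
  have h1 : ∀ η : ℝ, 0 < η →
      ENNReal.ofReal ((∫ x, ‖g x‖) - η * volume.real (univ : Set (Torus d ℓ))) ≤ W := by
    intro η hη
    refine le_trans (ENNReal.ofReal_le_ofReal ?_) (h η hη)
    have : (∫ x, ‖g x‖) - η * volume.real (univ : Set (Torus d ℓ)) = ∫ x, (‖g x‖ - η) := by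
      rw [integral_sub (integrable_of_continuous hg.norm) (integrable_const _)]
      simp [mul_comm]
    rw [this]
    refine integral_mono ((integrable_of_continuous hg.norm).sub (integrable_const _))
      (integrable_of_continuous ?_) fun x => sub_le_sq_div_sqrt (norm_nonneg _) hη
    refine (hg.norm.pow 2).div (by fun_prop) fun x => ?_
    exact (Real.sqrt_pos.2 (by positivity)).ne'
  rw [h0]
  have h2 : Tendsto (fun η : ℝ => ENNReal.ofReal
      ((∫ x, ‖g x‖) - η * volume.real (univ : Set (Torus d ℓ)))) (𝓝[>] 0)
      (𝓝 (ENNReal.ofReal (∫ x, ‖g x‖))) := by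
    have : Continuous fun η : ℝ => ENNReal.ofReal
      ((∫ x, ‖g x‖) - η * volume.real (univ : Set (Torus d ℓ))) :=
      ENNReal.continuous_ofReal.comp (by fun_prop)
    simpa using (this.tendsto 0).mono_left nhdsWithin_le_nhds
  exact le_of_tendsto h2 (eventually_mem_nhdsWithin.mono fun η hη => h1 η hη)

theorem ofReal_neg_integral_le {g : Torus d ℓ → ℝ} {f : Torus d ℓ → ℝ≥0∞}
    (h : ∀ x, ‖g x‖ₑ ≤ f x) : ENNReal.ofReal (-∫ x, g x) ≤ ∫⁻ x, f x := by
  rw [← integral_neg]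
  refine (Real.ofReal_le_enorm _).trans ((enorm_integral_le_lintegral_enorm _).trans ?_)
  exact lintegral_mono fun x => by simpa using h x

/-- Integration by parts gives one inequality; the other comes from testing with the smoothed sign
of $-\omega\cdot\nabla f$. -/
theorem dirVariation_of_isSmooth {f : Torus d ℓ → ℝ} (h : IsSmooth f) (ω : E d) :
    dirVariation ω f = ∫⁻ x, ‖dirDeriv ω f x‖ₑ := by
  apply le_antisymm
  · refine iSup_le fun φ => iSup_le fun hφ => iSup_le fun hb => ?_
    rw [integral_mul_dirDeriv h hφ]
    refine ofReal_neg_integral_le fun x => ?_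
    rw [enorm_mul]
    refine mul_le_of_le_one_right' ?_
    rw [Real.enorm_eq_ofReal_abs]
    simpa using hb x
  · have hg := h.dirDeriv ω
    refine lintegral_norm_le_of_regularized hg.continuous fun η hη => ?_
    have hpos : ∀ x, 0 < dirDeriv ω f x ^ 2 + η ^ 2 := fun x => by positivity
    let φ : Torus d ℓ → ℝ := fun x => -dirDeriv ω f x / √(dirDeriv ω f x ^ 2 + η ^ 2)
    have hφ : IsSmooth φ := by
      refine ContDiff.div (ContDiff.neg hg) (ContDiff.sqrt ((ContDiff.pow hg 2).add contDiff_const)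
        fun x => (hpos _).ne') fun x => (Real.sqrt_pos.2 (hpos _)).ne'
    have hb : ∀ x, |φ x| ≤ 1 := by
      intro x
      rw [abs_div, abs_neg, abs_of_pos (Real.sqrt_pos.2 (hpos x)),
        div_le_one (Real.sqrt_pos.2 (hpos x))]
      exact Real.abs_le_sqrt (by nlinarith)
    have : ∫ x, ‖dirDeriv ω f x‖ ^ 2 / √(‖dirDeriv ω f x‖ ^ 2 + η ^ 2)
        = ∫ x, f x * dirDeriv ω φ x := by
      rw [integral_mul_dirDeriv h hφ, ← integral_neg]
      refine integral_congr_ae (ae_of_all _ fun x => ?_)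
      simp only [φ, Real.norm_eq_abs, sq_abs]
      ring
    rw [this]
    exact le_iSup_of_le φ (le_iSup_of_le hφ (le_iSup_of_le hb le_rfl))

theorem totalVariation_of_isSmooth {f : Torus d ℓ → ℝ} (h : IsSmooth f) :
    totalVariation f = ∫⁻ x, ‖grad f x‖ₑ := by
  apply le_antisymm
  · refine iSup_le fun Φ => iSup_le fun hΦ => iSup_le fun hb => ?_
    rw [integral_mul_divergence h hΦ]
    refine ofReal_neg_integral_le fun x => ?_
    rw [← ofReal_norm, ← ofReal_norm]
    refine ENNReal.ofReal_le_ofReal ((norm_inner_le_norm _ _).trans ?_)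
    exact mul_le_of_le_one_right (norm_nonneg _) (hb x)
  · have hg := h.grad
    refine lintegral_norm_le_of_regularized hg.continuous fun η hη => ?_
    have hpos : ∀ x, 0 < ‖grad f x‖ ^ 2 + η ^ 2 := fun x => by positivity
    let Φ : Torus d ℓ → E d := fun x => (-(√(‖grad f x‖ ^ 2 + η ^ 2))⁻¹) • grad f x
    have hΦ : IsSmooth Φ := by
      refine ContDiff.smul (ContDiff.neg (ContDiff.inv (ContDiff.sqrt ((ContDiff.norm_sq ℝ hg).add
        contDiff_const) fun x => (hpos _).ne') fun x => (Real.sqrt_pos.2 (hpos _)).ne')) hg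
    have hb : ∀ x, ‖Φ x‖ ≤ 1 := by
      intro x
      have h1 := Real.sqrt_pos.2 (hpos x)
      rw [norm_smul, norm_neg, norm_inv, Real.norm_of_nonneg h1.le, inv_mul_le_iff₀ h1, mul_one]
      exact Real.le_sqrt_of_sq_le (by nlinarith)
    have : ∫ x, ‖grad f x‖ ^ 2 / √(‖grad f x‖ ^ 2 + η ^ 2) = ∫ x, f x * divergence Φ x := by
      rw [integral_mul_divergence h hΦ, ← integral_neg]
      refine integral_congr_ae (ae_of_all _ fun x => ?_)
      simp only [Φ, inner_smul_right, real_inner_self_eq_norm_sq]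
      ring
    rw [this]
    exact le_iSup_of_le Φ (le_iSup_of_le hΦ (le_iSup_of_le hb le_rfl))

/-- The increment is the integral of $z\cdot\nabla f$ along the segment from $x$ to $x+z$, and each
point of the segment contributes equally by translation invariance. -/
theorem translationDist_le_of_isSmooth {f : Torus d ℓ → ℝ} (h : IsSmooth f) (z : E d) :
    translationDist f (proj ℓ z) ≤ dirVariation z f := by
  have hc : Continuous (dirDeriv z f) := (h.dirDeriv z).continuous
  have hpc : Continuous fun t : ℝ => proj ℓ (t • z) := continuous_proj.comp (by fun_prop)
  have h1 : ∀ x, ‖f (x + proj ℓ z) - f x‖ₑ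
      ≤ ∫⁻ t in Ioc (0 : ℝ) 1, ‖dirDeriv z f (x + proj ℓ (t • z))‖ₑ := by
    intro x
    have : f (x + proj ℓ z) - f x
        = ∫ t in Ioc (0 : ℝ) 1, dirDeriv z f (x + proj ℓ (t • z)) := by
      rw [← intervalIntegral.integral_of_le zero_le_one,
        intervalIntegral.integral_eq_sub_of_hasDerivAt
        (fun t _ => h.hasDerivAt_dirDeriv z x t)]
      · simp
      · exact (hc.comp (by fun_prop)).intervalIntegrable _ _
    rw [this]
    exact enorm_integral_le_lintegral_enorm _
  rw [dirVariation_of_isSmooth h]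
  refine (lintegral_mono h1).trans ?_
  rw [lintegral_lintegral_swap]
  · simp_rw [lintegral_add_right_eq_self (fun x => ‖dirDeriv z f x‖ₑ)]
    simp
  · exact (hc.comp (continuous_fst.add (hpc.comp continuous_snd))).enorm.measurable.aemeasurable

end Smooth

end Smoothing

/-! ### Polar coordinates and the spherical mean of a linear form -/

section Polar

variable {d : ℕ}

theorem lintegral_volumeIoiPow (n : ℕ) {k : ℝ → ℝ≥0∞} (hk : Measurable k) :
    ∫⁻ r : Ioi (0 : ℝ), k r ∂(Measure.volumeIoiPow n)
      = ∫⁻ r in Ioi (0 : ℝ), k r * ENNReal.ofReal (r ^ n) := by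
  rw [Measure.volumeIoiPow, lintegral_withDensity_eq_lintegral_mul _ (by fun_prop) (by fun_prop),
    ← lintegral_subtype_comap measurableSet_Ioi]
  simp [mul_comm]

/-- Integration in polar coordinates of a product of a radial and an angular function. -/
theorem lintegral_polar [NeZero d] {k : ℝ → ℝ≥0∞} (hk : Measurable k) {h : E d → ℝ≥0∞}
    (hh : Measurable h) :
    ∫⁻ z : E d, k ‖z‖ * h (‖z‖⁻¹ • z)
      = (∫⁻ s : Metric.sphere (0 : E d) 1, h s ∂(volume : Measure (E d)).toSphere)
        * ∫⁻ r in Ioi (0 : ℝ), k r * ENNReal.ofReal (r ^ (d - 1)) := by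
  have hd : Module.finrank ℝ (E d) = d := by simp
  calc ∫⁻ z : E d, k ‖z‖ * h (‖z‖⁻¹ • z)
      = ∫⁻ z : ({(0)}ᶜ : Set (E d)), k ‖z.1‖ * h (‖z.1‖⁻¹ • z.1)
          ∂((volume : Measure (E d)).comap (↑)) := by
        rw [lintegral_subtype_comap (measurableSet_singleton (0 : E d)).compl
          fun z : E d => k ‖z‖ * h (‖z‖⁻¹ • z), restrict_compl_singleton]
    _ = ∫⁻ x : Metric.sphere (0 : E d) 1 × Ioi (0 : ℝ), h x.1 * k x.2
          ∂(volume : Measure (E d)).toSphere.prod (.volumeIoiPow (d - 1)) := by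
        have := (volume : Measure (E d)).measurePreserving_homeomorphUnitSphereProd
        rw [hd] at this
        rw [← this.lintegral_comp (by fun_prop)]
        simp [mul_comm]
    _ = _ := by
        rw [lintegral_prod_mul (f := fun s : Metric.sphere (0 : E d) 1 => h s)
          (g := fun r : Ioi (0 : ℝ) => k r) (by fun_prop) (by fun_prop),
          lintegral_volumeIoiPow _ hk]

theorem integral_abs_mul_exp_neg_sq : ∫ t : ℝ, |t| * Real.exp (-t ^ 2) = 1 := by
  have h1 := integral_comp_abs (f := fun t : ℝ => t * Real.exp (-t ^ 2))
  simp only [sq_abs] at h1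
  have h2 := integral_rpow_mul_exp_neg_rpow (p := 2) (q := 1) (by norm_num) (by norm_num)
  norm_num at h2
  rw [h1, h2]
  norm_num

theorem integrable_abs_mul_exp_neg_sq : Integrable fun t : ℝ => |t| * Real.exp (-t ^ 2) := by
  -- The integral of a nonintegrable function is 0 by convention, whereas this one has been computed
  -- to be 1.
  by_contra h
  have := integral_undef h
  rw [integral_abs_mul_exp_neg_sq] at this
  norm_num at this

theorem integral_exp_neg_sq : ∫ t : ℝ, Real.exp (-t ^ 2) = √Real.pi := by
  simpa using integral_gaussian 1

theorem integrable_exp_neg_sq : Integrable fun t : ℝ => Real.exp (-t ^ 2) := by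
  simpa using integrable_exp_neg_mul_sq (b := 1) one_pos

/-- The integrand is a product over the coordinates: the distinguished one contributes 1, each of
the others $\sqrt\pi$. -/
theorem lintegral_exp_neg_sq_mul_abs_apply (i₀ : Fin d) :
    ∫⁻ z : E d, ENNReal.ofReal (Real.exp (-‖z‖ ^ 2)) * ‖z i₀‖ₑ
      = ENNReal.ofReal (√Real.pi ^ (d - 1)) := by
  let f : Fin d → ℝ → ℝ := fun i t =>
    if i = i₀ then |t| * Real.exp (-t ^ 2) else Real.exp (-t ^ 2)
  have hf : ∀ i, Integrable (f i) := by
    intro i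
    by_cases hi : i = i₀
    · simpa [f, hi] using integrable_abs_mul_exp_neg_sq
    · simpa [f, hi] using integrable_exp_neg_sq
  have hprod : ∀ y : Fin d → ℝ, ∏ i, f i (y i) = |y i₀| * Real.exp (-∑ i, y i ^ 2) := by
    intro y
    have : ∀ i, f i (y i) = (if i = i₀ then |y i| else 1) * Real.exp (-y i ^ 2) := by
      intro i
      by_cases hi : i = i₀ <;> simp [f, hi]
    simp_rw [this, Finset.prod_mul_distrib, ← Real.exp_sum, Finset.sum_neg_distrib]
    simp
  have h1 : ∀ z : E d, ENNReal.ofReal (Real.exp (-‖z‖ ^ 2)) * ‖z i₀‖ₑ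
      = ENNReal.ofReal (∏ i, f i (WithLp.ofLp z i)) := by
    intro z
    rw [hprod, mul_comm |_|, ENNReal.ofReal_mul (Real.exp_nonneg _), EuclideanSpace.real_norm_sq_eq,
      Real.enorm_eq_ofReal_abs]
  simp_rw [h1]
  rw [(PiLp.volume_preserving_ofLp (Fin d)).lintegral_comp_emb
      (MeasurableEquiv.toLp 2 (Fin d → ℝ)).symm.measurableEmbedding
      (fun y => ENNReal.ofReal (∏ i, f i (y i))),
    ← ofReal_integral_eq_lintegral_ofReal (volume_pi (α := fun _ : Fin d => ℝ) ▸ Integrable.fintype_prod hf)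
      (ae_of_all _ fun y => by rw [hprod]; positivity),
    integral_fintype_prod_volume_eq_prod]
  congr 1
  rw [← Finset.mul_prod_erase _ _ (Finset.mem_univ i₀),
    Finset.prod_congr rfl (g := fun _ => √Real.pi)]
  · simp [f, integral_abs_mul_exp_neg_sq]
  · intro i hi
    simp [f, Finset.ne_of_mem_erase hi, integral_exp_neg_sq]

theorem lintegral_exp_neg_sq_mul_abs_inner [NeZero d] (p : E d) :
    ∫⁻ z : E d, ENNReal.ofReal (Real.exp (-‖z‖ ^ 2)) * ‖(inner ℝ z p : ℝ)‖ₑ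
      = ‖p‖ₑ * ENNReal.ofReal (√Real.pi ^ (d - 1)) := by
  rcases eq_or_ne p 0 with rfl | hp
  · simp
  have hp' : ‖p‖ ≠ 0 := norm_ne_zero_iff.2 hp
  -- Rotating so that $p/|p|$ becomes the first basis vector reduces to a coordinate function.
  obtain ⟨b, hb⟩ := Orthonormal.exists_orthonormalBasis_extension_of_card_eq (𝕜 := ℝ)
    (E := E d) (ι := Fin d) (by simp) (v := fun _ => ‖p‖⁻¹ • p) (s := {0})
    (by
      constructor
      · rintro ⟨i, hi⟩
        simp [norm_smul, hp']
      · rintro ⟨i, hi⟩ ⟨j, hj⟩ hij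
        exact absurd (Subtype.ext (hi.trans hj.symm)) hij)
  have hb0 : b 0 = ‖p‖⁻¹ • p := hb 0 rfl
  have h1 : ∀ z : E d, ENNReal.ofReal (Real.exp (-‖z‖ ^ 2)) * ‖(inner ℝ z p : ℝ)‖ₑ
      = ‖p‖ₑ * (ENNReal.ofReal (Real.exp (-‖b.repr z‖ ^ 2)) * ‖b.repr z 0‖ₑ) := by
    intro z
    have : (inner ℝ z p : ℝ) = ‖p‖ * b.repr z 0 := by
      rw [b.repr_apply_apply, hb0, real_inner_smul_left, real_inner_comm]
      field_simp
    rw [this, enorm_mul, LinearIsometryEquiv.norm_map, enorm_norm]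
    ring
  simp_rw [h1]
  rw [lintegral_const_mul _ (by fun_prop), b.measurePreserving_repr.lintegral_comp
    (f := fun z : E d => ENNReal.ofReal (Real.exp (-‖z‖ ^ 2)) * ‖z 0‖ₑ) (by fun_prop),
    lintegral_exp_neg_sq_mul_abs_apply]

theorem volume_unit_ball (n : ℕ) :
    volume (Metric.ball (0 : E n) 1)
      = ENNReal.ofReal (√Real.pi ^ n / Real.Gamma (n / 2 + 1)) := by
  -- Dimension zero occurs as $d-1$ for $d=1$; the ball is then a single point of measure one.
  rcases Nat.eq_zero_or_pos n with rfl | hn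
  · have : Metric.ball (0 : E 0) 1 = univ := by
      ext x; simp [Subsingleton.elim x 0]
    have h := (PiLp.volume_preserving_ofLp (Fin 0)).measure_preimage
      (nullMeasurableSet_univ (α := Fin 0 → ℝ))
    rw [preimage_univ] at h
    rw [this, h, volume_pi, Measure.pi_univ]
    simp
  · have : Nonempty (Fin n) := ⟨⟨0, hn⟩⟩
    simp [EuclideanSpace.volume_ball]

/-- The mean of `|ω · p|` over the unit sphere is twice the volume of the unit ball of one
dimension less, times `|p|`. -/
theorem lintegral_sphere_abs_inner [NeZero d] (p : E d) :
    ∫⁻ s : Metric.sphere (0 : E d) 1, ‖(inner ℝ (s : E d) p : ℝ)‖ₑ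
        ∂(volume : Measure (E d)).toSphere
      = 2 * volume (Metric.ball (0 : E (d - 1)) 1) * ‖p‖ₑ := by
  have hd : 1 ≤ d := NeZero.one_le
  -- The spherical mean is read off from one radial weight for which the full integral is known.
  -- With $re^{-r^2}$ the factor $r$ cancels the normalization of $z/|z|$, leaving the Gaussian
  -- integral of $|z\cdot p|$.
  have h1 := lintegral_polar (d := d) (k := fun r => ENNReal.ofReal (r * Real.exp (-r ^ 2)))
    (by fun_prop) (h := fun z => ‖(inner ℝ z p : ℝ)‖ₑ) (by fun_prop)
  have h2 : ∀ z : E d, ENNReal.ofReal (‖z‖ * Real.exp (-‖z‖ ^ 2))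
      * ‖(inner ℝ (‖z‖⁻¹ • z) p : ℝ)‖ₑ
      = ENNReal.ofReal (Real.exp (-‖z‖ ^ 2)) * ‖(inner ℝ z p : ℝ)‖ₑ := by
    intro z
    rcases eq_or_ne z 0 with rfl | hz
    · simp
    have hz' : 0 < ‖z‖ := norm_pos_iff.2 hz
    rw [real_inner_smul_left, enorm_mul, mul_comm ‖z‖, ENNReal.ofReal_mul (Real.exp_nonneg _),
      ← mul_assoc, mul_assoc (ENNReal.ofReal _), enorm_inv hz'.ne', enorm_norm, ofReal_norm,
      ENNReal.mul_inv_cancel (by simpa using hz) (by simp), mul_one]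
  simp_rw [h2] at h1
  rw [lintegral_exp_neg_sq_mul_abs_inner] at h1
  have h3 : ∫⁻ r in Ioi (0 : ℝ), ENNReal.ofReal (r * Real.exp (-r ^ 2))
      * ENNReal.ofReal (r ^ (d - 1)) = ENNReal.ofReal (Real.Gamma ((d + 1) / 2) / 2) := by
    have h4 := integral_rpow_mul_exp_neg_rpow (p := 2) (q := d) (by norm_num)
      (lt_of_lt_of_le (by norm_num) (Nat.cast_nonneg d))
    norm_num at h4
    have hG : 0 < Real.Gamma (((d : ℝ) + 1) / 2) := Real.Gamma_pos_of_pos (by positivity)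
    have h5 : IntegrableOn (fun x : ℝ => x ^ d * Real.exp (-x ^ 2)) (Ioi 0) := by
      by_contra h
      have := integral_undef h
      rw [h4] at this
      linarith
    rw [show Real.Gamma (((d : ℝ) + 1) / 2) / 2 = 1 / 2 * Real.Gamma (((d : ℝ) + 1) / 2) by ring,
      ← h4, ofReal_integral_eq_lintegral_ofReal h5]
    · refine setLIntegral_congr_fun measurableSet_Ioi fun r hr => ?_
      have hr' : (0 : ℝ) < r := hr
      rw [← ENNReal.ofReal_mul (by positivity)]
      congr 1
      obtain ⟨n, rfl⟩ := Nat.exists_eq_add_of_le' hd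
      simp only [Nat.add_sub_cancel, pow_succ]
      ring
    · filter_upwards [ae_restrict_mem measurableSet_Ioi] with r hr
      have hr' : (0 : ℝ) < r := hr
      positivity
  rw [h3] at h1
  have hG : 0 < Real.Gamma (((d : ℝ) + 1) / 2) := Real.Gamma_pos_of_pos (by positivity)
  have h6 : (ENNReal.ofReal (Real.Gamma ((d + 1) / 2) / 2)) ≠ 0 := by
    simp only [ne_eq, ENNReal.ofReal_eq_zero, not_le]; positivity
  rw [← ENNReal.mul_left_inj h6 ENNReal.ofReal_ne_top, ← h1, volume_unit_ball]
  -- The Gamma value of the radial integral is the one in the volume of the $(d-1)$-dimensional unit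
  -- ball, so the two cancel.
  have h7 : ((d - 1 : ℕ) : ℝ) / 2 + 1 = (d + 1) / 2 := by
    rw [Nat.cast_sub hd]; push_cast; ring
  rw [h7, mul_right_comm, mul_comm ‖p‖ₑ]
  congr 1
  rw [← ENNReal.ofReal_ofNat, ← ENNReal.ofReal_mul (by norm_num),
    ← ENNReal.ofReal_mul (by positivity)]
  congr 1
  field_simp

/-- Integration of a radial kernel against `|z/|z| · p|`. -/
theorem lintegral_radial_mul_abs_inner [NeZero d] {k : ℝ → ℝ≥0∞} (hk : Measurable k) (p : E d) :
    ∫⁻ z : E d, k ‖z‖ * ‖(inner ℝ (‖z‖⁻¹ • z) p : ℝ)‖ₑ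
      = 2 * volume (Metric.ball (0 : E (d - 1)) 1)
        * (∫⁻ r in Ioi (0 : ℝ), k r * ENNReal.ofReal (r ^ (d - 1))) * ‖p‖ₑ := by
  rw [lintegral_polar hk (h := fun z => ‖(inner ℝ z p : ℝ)‖ₑ) (by fun_prop),
    lintegral_sphere_abs_inner, mul_right_comm]

end Polar

/-! ### Directional variations and their average over directions -/

section DirectionalVariation

variable {d : ℕ} {ℓ : ℝ}

/-- The integral over `ℝ^d` of `k(|z|) |z/|z| · e|`, for a unit vector `e`. -/
def radialMass (d : ℕ) (k : ℝ → ℝ≥0∞) : ℝ≥0∞ :=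
  2 * volume (Metric.ball (0 : E (d - 1)) 1)
    * ∫⁻ r in Ioi (0 : ℝ), k r * ENNReal.ofReal (r ^ (d - 1))

section Variations

variable [Fact (0 < ℓ)]

theorem translationDist_le_add {u v : Torus d ℓ → ℝ} (hu : Integrable u) (hv : Integrable v)
    (a : Torus d ℓ) :
    translationDist u a ≤ translationDist v a + 2 * ∫⁻ x, ‖v x - u x‖ₑ := by
  have h1 : ∀ x, ‖u (x + a) - u x‖ₑ
      ≤ ‖v (x + a) - v x‖ₑ + (‖v (x + a) - u (x + a)‖ₑ + ‖v x - u x‖ₑ) := by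
    intro x
    have : u (x + a) - u x = (v (x + a) - v x) + (-(v (x + a) - u (x + a)) + (v x - u x)) := by
      ring
    rw [this]
    refine (enorm_add_le _ _).trans ?_
    gcongr
    refine (enorm_add_le _ _).trans ?_
    rw [enorm_neg]
  have h2 : AEMeasurable fun x => ‖v (x + a) - u (x + a)‖ₑ :=
    ((hv.comp_add_right a).sub (hu.comp_add_right a)).1.enorm
  have h3 : AEMeasurable fun x => ‖v (x + a) - v x‖ₑ := ((hv.comp_add_right a).sub hv).1.enorm
  refine (lintegral_mono h1).trans ?_
  rw [lintegral_add_left' h3, lintegral_add_left' h2,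
    lintegral_add_right_eq_self (fun x => ‖v x - u x‖ₑ), two_mul, translationDist]

theorem tendsto_translationDist_of_tendsto {ι : Type*} {l : Filter ι}
    {u : Torus d ℓ → ℝ} {v : ι → Torus d ℓ → ℝ} (hu : Integrable u) (hv : ∀ i, Integrable (v i))
    (hlim : Tendsto (fun i => ∫⁻ x, ‖v i x - u x‖ₑ) l (𝓝 0)) (a : Torus d ℓ) :
    Tendsto (fun i => translationDist (v i) a) l (𝓝 (translationDist u a)) := by
  have h0 : Tendsto (fun i => 2 * ∫⁻ x, ‖v i x - u x‖ₑ) l (𝓝 0) := by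
    simpa using ENNReal.Tendsto.const_mul hlim (Or.inr ENNReal.ofNat_ne_top)
  have h1 : Tendsto (fun i => translationDist u a - 2 * ∫⁻ x, ‖v i x - u x‖ₑ) l
      (𝓝 (translationDist u a)) := by
    simpa using ENNReal.Tendsto.sub tendsto_const_nhds h0 (Or.inr ENNReal.zero_ne_top)
  have h2 : Tendsto (fun i => translationDist u a + 2 * ∫⁻ x, ‖v i x - u x‖ₑ) l
      (𝓝 (translationDist u a)) := by
    simpa using tendsto_const_nhds.add h0
  refine tendsto_of_tendsto_of_tendsto_of_le_of_le h1 h2 (fun i => ?_) fun i => ?_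
  · exact tsub_le_iff_right.2 (translationDist_le_add hu (hv i) a)
  · have := translationDist_le_add (hv i) hu a
    simpa only [enorm_sub_rev] using this

/-- The `L¹` modulus of continuity is controlled by the directional variation. -/
theorem translationDist_le_dirVariation {u : Torus d ℓ → ℝ} (h : UnitBounded u) (z : E d) :
    translationDist u (proj ℓ z) ≤ dirVariation z u := by
  obtain ⟨v, hv, hvb, hvS, hlim⟩ := exists_smooth_approx h
  refine le_of_tendsto (tendsto_translationDist_of_tendsto h.integrable
    (fun n => (hvb n).integrable) hlim (proj ℓ z)) (Eventually.of_forall fun n => ?_)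
  refine (translationDist_le_of_isSmooth (hv n) z).trans ?_
  rw [dirVariation_eq_testSup, dirVariation_eq_testSup]
  exact hvS n _ (isTestFamily_dirTests z)

/-- Each pairing is linear in `ω`, so the supremum is lower semicontinuous although it ranges over
uncountably many test functions. -/
theorem measurable_dirVariation {u : Torus d ℓ → ℝ} (h : Integrable u) :
    Measurable fun ω : E d => dirVariation ω u := by
  refine LowerSemicontinuous.measurable ?_
  refine lowerSemicontinuous_iSup fun φ => lowerSemicontinuous_iSup fun hφ =>
    lowerSemicontinuous_iSup fun hb => Continuous.lowerSemicontinuous ?_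
  refine ENNReal.continuous_ofReal.comp ?_
  have hi : ∀ ω : E d, Integrable fun x => u x * dirDeriv ω φ x := by
    intro ω
    have hc := (hφ.dirDeriv ω).continuous
    obtain ⟨C, hC⟩ := exists_bound_of_continuous hc
    exact h.mul_bdd hc.aestronglyMeasurable (ae_of_all _ hC)
  have : ∀ ω : E d, ∫ x, u x * dirDeriv ω φ x
      = ∑ i, ω i * ∫ x, u x * dirDeriv (EuclideanSpace.single i (1 : ℝ)) φ x := by
    intro ω
    have h1 : ∀ x, u x * dirDeriv ω φ x
        = ∑ i, ω i * (u x * dirDeriv (EuclideanSpace.single i (1 : ℝ)) φ x) := by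
      intro x
      rw [hφ.dirDeriv_eq_sum ω, Finset.mul_sum]
      exact Finset.sum_congr rfl fun i _ => mul_left_comm _ _ _
    simp_rw [h1]
    rw [integral_finsetSum _ fun i _ => (hi _).const_mul _]
    simp_rw [integral_const_mul]
  exact (continuous_congr this).2 (by fun_prop)

theorem dirVariation_le_liminf (ω : E d) {ι : Type*} {l : Filter ι} [l.NeBot]
    {u : Torus d ℓ → ℝ} {v : ι → Torus d ℓ → ℝ} (hu : Integrable u) (hv : ∀ i, Integrable (v i))
    (hlim : Tendsto (fun i => ∫⁻ x, ‖v i x - u x‖ₑ) l (𝓝 0)) :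
    dirVariation ω u ≤ liminf (fun i => dirVariation ω (v i)) l := by
  simp_rw [dirVariation_eq_testSup]
  exact (isTestFamily_dirTests ω).testSup_le_liminf hu hv hlim

theorem totalVariation_le_liminf {ι : Type*} {l : Filter ι} [l.NeBot]
    {u : Torus d ℓ → ℝ} {v : ι → Torus d ℓ → ℝ} (hu : Integrable u) (hv : ∀ i, Integrable (v i))
    (hlim : Tendsto (fun i => ∫⁻ x, ‖v i x - u x‖ₑ) l (𝓝 0)) :
    totalVariation u ≤ liminf (fun i => totalVariation (v i)) l := by
  simp_rw [totalVariation_eq_testSup]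
  exact isTestFamily_divTests.testSup_le_liminf hu hv hlim

theorem dirVariation_smul {c : ℝ} (hc : 0 ≤ c) (ω : E d) {u : Torus d ℓ → ℝ} :
    dirVariation (c • ω) u = ENNReal.ofReal c * dirVariation ω u := by
  simp only [dirVariation, ENNReal.mul_iSup]
  refine iSup_congr fun φ => iSup_congr fun hφ => iSup_congr fun _ => ?_
  rw [← ENNReal.ofReal_mul hc, ← integral_const_mul]
  exact congrArg ENNReal.ofReal (integral_congr_ae (ae_of_all _ fun x => by
    simp only [hφ.dirDeriv_smul]; ring))

theorem dirVariation_le_of_isSmooth {f : Torus d ℓ → ℝ} (h : IsSmooth f) (ω : E d) :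
    dirVariation ω f ≤ ‖ω‖ₑ * totalVariation f := by
  rw [dirVariation_of_isSmooth h, totalVariation_of_isSmooth h,
    ← lintegral_const_mul' _ _ (by simp)]
  refine lintegral_mono fun x => ?_
  rw [h.dirDeriv_eq_inner, ← ofReal_norm, ← ofReal_norm, ← ofReal_norm,
    ← ENNReal.ofReal_mul (norm_nonneg _)]
  exact ENNReal.ofReal_le_ofReal (norm_inner_le_norm _ _)

theorem dirVariation_le {u : Torus d ℓ → ℝ} (h : UnitBounded u) (ω : E d) :
    dirVariation ω u ≤ ‖ω‖ₑ * totalVariation u := by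
  obtain ⟨v, hv, hvb, hvS, hlim⟩ := exists_smooth_approx h
  refine (dirVariation_le_liminf ω h.integrable (fun n => (hvb n).integrable) hlim).trans ?_
  refine liminf_le_of_le (by isBoundedDefault) fun b hb => ?_
  obtain ⟨n, hn⟩ := hb.exists
  refine hn.trans ((dirVariation_le_of_isSmooth (hv n) ω).trans ?_)
  gcongr
  rw [totalVariation_eq_testSup, totalVariation_eq_testSup]
  exact hvS n _ isTestFamily_divTests

/-- By Tonelli the integral over `z` may be taken first at fixed `x`, where the vector `p` is the
gradient of `f` at `x`. -/
theorem lintegral_radial_mul_dirVariation_of_isSmooth [NeZero d] {k : ℝ → ℝ≥0∞}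
    (hk : Measurable k) {f : Torus d ℓ → ℝ} (h : IsSmooth f) :
    ∫⁻ z : E d, k ‖z‖ * dirVariation (‖z‖⁻¹ • z) f = radialMass d k * totalVariation f := by
  have hg : Measurable (grad f) := h.grad.continuous.measurable
  simp_rw [dirVariation_of_isSmooth h, totalVariation_of_isSmooth h, h.dirDeriv_eq_inner]
  rw [← lintegral_const_mul _ hg.enorm]
  simp_rw [radialMass, ← lintegral_radial_mul_abs_inner hk]
  rw [lintegral_lintegral_swap (by fun_prop)]
  refine lintegral_congr fun z => ?_
  rw [lintegral_const_mul _ (by fun_prop)]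

/-- The total variation is the mean of the directional variations. -/
theorem lintegral_radial_mul_dirVariation [NeZero d] {k : ℝ → ℝ≥0∞} (hk : Measurable k)
    (hk' : radialMass d k ≠ ∞) {u : Torus d ℓ → ℝ} (h : UnitBounded u) :
    ∫⁻ z : E d, k ‖z‖ * dirVariation (‖z‖⁻¹ • z) u = radialMass d k * totalVariation u := by
  obtain ⟨v, hv, hvb, hvS, hlim⟩ := exists_smooth_approx h
  have hi := fun n => (hvb n).integrable
  have hdle : ∀ n ω, dirVariation ω (v n) ≤ dirVariation ω u := fun n ω => by
    rw [dirVariation_eq_testSup, dirVariation_eq_testSup]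
    exact hvS n _ (isTestFamily_dirTests ω)
  have htle : ∀ n, totalVariation (v n) ≤ totalVariation u := fun n => by
    rw [totalVariation_eq_testSup, totalVariation_eq_testSup]
    exact hvS n _ isTestFamily_divTests
  have hmeas : ∀ w : Torus d ℓ → ℝ, Integrable w →
      Measurable fun z : E d => dirVariation (‖z‖⁻¹ • z) w := fun w hw =>
    (measurable_dirVariation hw).comp (by fun_prop)
  -- The mollifications have variations at most that of `u`, so lower semicontinuity upgrades to
  -- convergence, in every direction and for the total variation.
  have hd : ∀ ω, Tendsto (fun n => dirVariation ω (v n)) atTop (𝓝 (dirVariation ω u)) :=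
    fun ω => tendsto_of_le_liminf_of_limsup_le (dirVariation_le_liminf ω h.integrable hi hlim)
      (limsup_le_of_le (by isBoundedDefault) (Eventually.of_forall fun n => hdle n ω))
  have ht : Tendsto (fun n => totalVariation (v n)) atTop (𝓝 (totalVariation u)) :=
    tendsto_of_le_liminf_of_limsup_le (totalVariation_le_liminf h.integrable hi hlim)
      (limsup_le_of_le (by isBoundedDefault) (Eventually.of_forall fun n => htle n))
  have heq := fun n => lintegral_radial_mul_dirVariation_of_isSmooth hk (hv n)
  apply le_antisymm
  -- One inequality is Fatou's lemma; the other follows from the monotone bound on directional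
  -- variations.
  · calc ∫⁻ z : E d, k ‖z‖ * dirVariation (‖z‖⁻¹ • z) u
        ≤ ∫⁻ z : E d, liminf (fun n => k ‖z‖ * dirVariation (‖z‖⁻¹ • z) (v n)) atTop := by
          refine lintegral_mono fun z => ?_
          have h1 := ENNReal.le_liminf_mul (f := atTop) (u := fun _ : ℕ => k ‖z‖)
            (v := fun n => dirVariation (‖z‖⁻¹ • z) (v n))
          rw [liminf_const, (hd _).liminf_eq] at h1
          exact h1
      _ ≤ liminf (fun n => ∫⁻ z : E d, k ‖z‖ * dirVariation (‖z‖⁻¹ • z) (v n)) atTop :=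
          lintegral_liminf_le fun n => (hk.comp measurable_norm).mul (hmeas _ (hi n))
      _ ≤ radialMass d k * totalVariation u := by
          simp_rw [heq]
          refine liminf_le_of_le (by isBoundedDefault) fun b hb => ?_
          obtain ⟨n, hn⟩ := hb.exists
          exact hn.trans (mul_le_mul_right (htle n) _)
  -- Finite mass excludes the product $\infty\cdot0$, at which multiplication is discontinuous.
  · refine le_of_tendsto (ENNReal.Tendsto.const_mul ht (Or.inr hk'))
      (Eventually.of_forall fun n => ?_)
    rw [← heq]
    exact lintegral_mono fun z => mul_le_mul_right (hdle n _) _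

end Variations

end DirectionalVariation

/-! ### Precompactness in $L^1$ under a perimeter bound -/

section Precompactness

open BoundedContinuousFunction

variable {d : ℕ} {ℓ : ℝ} [Fact (0 < ℓ)]

theorem exists_unitBounded_rep {w : L1 d ℓ} (h : ∀ᵐ x, w x = 0 ∨ w x = 1) :
    ∃ u : Torus d ℓ → ℝ, UnitBounded u ∧ w =ᵐ[volume] u ∧ ∀ x, u x = 0 ∨ u x = 1 := by
  have hm := (Lp.aestronglyMeasurable w).aemeasurable
  have hms : MeasurableSet {x | hm.mk w x = 1} := hm.measurable_mk (measurableSet_singleton 1)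
  refine ⟨indicator {x | hm.mk w x = 1} 1, ⟨measurable_one.indicator hms, fun x => ?_⟩, ?_,
    fun x => ?_⟩
  · by_cases hx : hm.mk w x = 1 <;> simp [hx]
  · filter_upwards [h, hm.ae_eq_mk] with x hx hx'
    rcases hx with h0 | h0 <;> simp [← hx', h0]
  · by_cases hx : hm.mk w x = 1 <;> simp [hx]

theorem edist_L1 (v w : L1 d ℓ) : edist v w = ∫⁻ x, ‖v x - w x‖ₑ := by
  rw [Lp.edist_def, eLpNorm_one_eq_lintegral_enorm]
  rfl

theorem tendsto_L1_iff {ι : Type*} {l : Filter ι} {v : ι → L1 d ℓ} {w : L1 d ℓ} :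
    Tendsto v l (𝓝 w) ↔ Tendsto (fun i => ∫⁻ x, ‖v i x - w x‖ₑ) l (𝓝 0) := by
  rw [tendsto_iff_edist_tendsto_0]
  simp_rw [edist_L1]

/-- Continuous probability densities on the torus concentrated near the origin. -/
theorem exists_continuous_density {U : Set (Torus d ℓ)} (hU : IsOpen U) (h0 : (0 : Torus d ℓ) ∈ U) :
    ∃ ρ : Torus d ℓ → ℝ, Continuous ρ ∧ (∀ x, 0 ≤ ρ x) ∧ (∀ x, x ∉ U → ρ x = 0) ∧
      ∫⁻ x, ENNReal.ofReal (ρ x) = 1 := by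
  obtain ⟨f, hf0, hf1, hf⟩ := exists_continuous_zero_one_of_isClosed hU.isClosed_compl
    (isClosed_singleton (x := (0 : Torus d ℓ))) (by simpa using h0)
  have hpos : 0 < ∫ x, f x := f.continuous.integral_pos_of_hasCompactSupport_nonneg_nonzero
    (HasCompactSupport.of_compactSpace f) (fun x => (hf x).1) (x := 0)
    (by rw [hf1 (mem_singleton _)]; exact one_ne_zero)
  refine ⟨fun x => f x / ∫ x, f x, f.continuous.div_const _,
    fun x => div_nonneg (hf x).1 hpos.le, fun x hx => ?_, ?_⟩
  · simp [hf0 hx]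
  · rw [← ofReal_integral_eq_lintegral_ofReal
      (integrable_of_continuous (f.continuous.div_const _))
      (ae_of_all _ fun x => div_nonneg (hf x).1 hpos.le), integral_div, div_self hpos.ne',
      ENNReal.ofReal_one]

theorem mollify_withDensity {ρ : Torus d ℓ → ℝ} (hρ : Continuous ρ) (hρ0 : ∀ x, 0 ≤ ρ x)
    (u : Torus d ℓ → ℝ) (x : Torus d ℓ) :
    mollify (volume.withDensity fun a => ENNReal.ofReal (ρ a)) u x = ∫ a, ρ (x - a) * u a := by
  have : (volume : Measure (Torus d ℓ)).IsNegInvariant :=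
    Measure.IsAddHaarMeasure.isNegInvariant_of_regular volume
  rw [mollify, integral_withDensity_eq_integral_toReal_smul hρ.measurable.ennreal_ofReal (by simp),
    ← integral_sub_left_eq_self _ _ x]
  simp [ENNReal.toReal_ofReal (hρ0 _)]

/-- The modulus of continuity of `ρ` passes to the convolution with a constant depending only on the
bound 1 for `u`, so `δ` does not depend on `u`. -/
theorem equicontinuous_mollify {ρ : Torus d ℓ → ℝ} (hρ : Continuous ρ) (hρ0 : ∀ x, 0 ≤ ρ x) :
    ∀ ε > 0, ∃ δ > 0, ∀ u : Torus d ℓ → ℝ, UnitBounded u → ∀ x y, dist x y < δ →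
      dist (mollify (volume.withDensity fun a => ENNReal.ofReal (ρ a)) u x)
        (mollify (volume.withDensity fun a => ENNReal.ofReal (ρ a)) u y) < ε := by
  intro ε hε
  set V := volume.real (univ : Set (Torus d ℓ)) with hV
  have hV0 : 0 ≤ V := measureReal_nonneg
  obtain ⟨δ, hδ, h⟩ := Metric.uniformContinuous_iff.1
    (CompactSpace.uniformContinuous_of_continuous hρ) (ε / (V + 1)) (by positivity)
  refine ⟨δ, hδ, fun u hu x y hxy => ?_⟩
  have hi : ∀ x, Integrable fun a => ρ (x - a) * u a := fun x =>
    hu.integrable.bdd_mul (c := (exists_bound_of_continuous hρ).choose)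
      (hρ.comp (continuous_const.sub continuous_id)).aestronglyMeasurable
      (ae_of_all _ fun a => (exists_bound_of_continuous hρ).choose_spec _)
  rw [mollify_withDensity hρ hρ0, mollify_withDensity hρ hρ0, dist_eq_norm,
    ← integral_sub (hi x) (hi y)]
  have h1 : ∀ a, ‖ρ (x - a) * u a - ρ (y - a) * u a‖ ≤ ε / (V + 1) := by
    intro a
    rw [← sub_mul, norm_mul, ← mul_one (ε / (V + 1))]
    refine mul_le_mul ?_ (hu.abs_le a) (norm_nonneg _) (by positivity)
    rw [← dist_eq_norm]
    exact (h (by rwa [dist_sub_right])).le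
  refine (norm_integral_le_of_norm_le_const (ae_of_all _ h1)).trans_lt ?_
  rw [← hV, div_mul_eq_mul_div, div_lt_iff₀ (by positivity)]
  nlinarith

/-- Sets of characteristic functions of bounded perimeter are precompact in `L¹`. -/
theorem exists_tendsto_subseq_of_totalVariation_le {w : ℕ → L1 d ℓ}
    (hw : ∀ j, ∀ᵐ x, w j x = 0 ∨ w j x = 1) {C : ℝ≥0∞} (hC : C ≠ ∞)
    (hTV : ∀ j, totalVariation (w j : Torus d ℓ → ℝ) ≤ C) :
    ∃ v : L1 d ℓ, ∃ s : ℕ → ℕ, StrictMono s ∧ Tendsto (fun j => w (s j)) atTop (𝓝 v) := by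
  choose u hu hwu _ using fun j => exists_unitBounded_rep (hw j)
  have hN : ∀ j (z : E d), translationDist (u j) (proj ℓ z) ≤ ‖z‖ₑ * C := fun j z =>
    (translationDist_le_dirVariation (hu j) z).trans ((dirVariation_le (hu j) z).trans (by
      rw [← totalVariation_congr (hwu j)]
      gcongr
      exact hTV j))
  -- Mollification at a fixed small scale moves every member by at most `η / 2`, by the perimeter
  -- bound, and the mollified family is relatively compact by Arzelà–Ascoli. A finite `η / 2`-net of
  -- it is a finite `η`-net of the sequence.
  have htb : TotallyBounded (range w) := by
    rw [EMetric.totallyBounded_iff]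
    intro η hη
    have hη2 : 0 < η / 2 := ENNReal.half_pos hη.ne'
    have h1 : Tendsto (fun z : E d => ‖z‖ₑ * C) (𝓝 0) (𝓝 0) := by
      have h2 := ENNReal.Tendsto.mul_const (b := C)
        ((continuous_enorm (E := E d)).tendsto 0) (Or.inr hC)
      simpa using h2
    obtain ⟨r, hr, hr'⟩ := Metric.eventually_nhds_iff_ball.1
      (h1.eventually (gt_mem_nhds (ENNReal.half_pos hη2.ne')))
    let U : Set (Torus d ℓ) := proj ℓ '' Metric.ball 0 r
    obtain ⟨ρ, hρ, hρ0, hρU, hρ1⟩ := exists_continuous_density (U := U)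
      (isOpenQuotientMap_proj.isOpenMap _ Metric.isOpen_ball)
      ⟨0, Metric.mem_ball_self hr, proj_zero⟩
    let μ : Measure (Torus d ℓ) := volume.withDensity fun a => ENNReal.ofReal (ρ a)
    have hμ : IsProbabilityMeasure μ := ⟨by simpa [μ] using hρ1⟩
    have hequi := equicontinuous_mollify hρ hρ0
    have hcont : ∀ j, Continuous (mollify μ (u j)) := fun j =>
      Metric.continuous_iff.2 fun x ε hε => by
        obtain ⟨δ, hδ, h⟩ := hequi ε hε
        exact ⟨δ, hδ, fun y hy => h (u j) (hu j) y x hy⟩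
    let g : ℕ → Torus d ℓ →ᵇ ℝ := fun j => mkOfCompact ⟨mollify μ (u j), hcont j⟩
    have hcomp : IsCompact (closure (range g)) := by
      refine arzela_ascoli (Icc (-1) 1) isCompact_Icc _ ?_ ?_
      · rintro _ x ⟨j, rfl⟩
        exact abs_le.1 ((hu j).mollify.abs_le x)
      · intro x
        rw [Metric.equicontinuousAt_iff]
        intro ε hε
        obtain ⟨δ, hδ, h⟩ := hequi ε hε
        refine ⟨δ, hδ, fun y hy => ?_⟩
        rintro ⟨_, j, rfl⟩
        rw [dist_comm] at hy
        exact h (u j) (hu j) x y hy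
    have htb' := (hcomp.image (BoundedContinuousFunction.toLp (E := ℝ) 1
      (volume : Measure (Torus d ℓ)) ℝ).continuous).totallyBounded
    obtain ⟨t, htf, ht⟩ := EMetric.totallyBounded_iff.1 htb' (η / 2) hη2
    refine ⟨t, htf, ?_⟩
    rintro _ ⟨j, rfl⟩
    have hj := ht (mem_image_of_mem _ (subset_closure (mem_range_self j)))
    simp only [mem_iUnion] at hj ⊢
    obtain ⟨y, hy, hy'⟩ := hj
    refine ⟨y, hy, ?_⟩
    have hd : edist (w j) (BoundedContinuousFunction.toLp (E := ℝ) 1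
        (volume : Measure (Torus d ℓ)) ℝ (g j)) ≤ η / 2 := by
      rw [edist_comm, edist_L1]
      have h2 : ∫⁻ x, ‖(BoundedContinuousFunction.toLp (E := ℝ) 1
          (volume : Measure (Torus d ℓ)) ℝ (g j)) x - w j x‖ₑ
          = ∫⁻ x, ‖mollify μ (u j) x - u j x‖ₑ := by
        refine lintegral_congr_ae ?_
        filter_upwards [BoundedContinuousFunction.coeFn_toLp (p := 1) (𝕜 := ℝ)
          (volume : Measure (Torus d ℓ)) (g j), hwu j] with x h3 h4
        rw [h3, h4]
        rfl
      rw [h2]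
      refine (lintegral_mollify_sub_le (hu j)).trans ?_
      have hm : Measurable fun a => translationDist (u j) (-a) :=
        (measurable_translationDist (hu j).measurable).comp measurable_neg
      rw [lintegral_withDensity_eq_lintegral_mul _ hρ.measurable.ennreal_ofReal hm]
      calc _ ≤ ∫⁻ a, ENNReal.ofReal (ρ a) * (η / 2) := by
            refine lintegral_mono fun a => ?_
            by_cases ha : a ∈ U
            · obtain ⟨z, hz, rfl⟩ := ha
              simp only [Pi.mul_apply]
              gcongr
              rw [← proj_neg]
              refine (hN j (-z)).trans ?_
              rw [enorm_neg]
              exact (hr' z hz).le.trans ENNReal.half_le_self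
            · simp [hρU a ha]
        _ = η / 2 := by
            rw [lintegral_mul_const _ hρ.measurable.ennreal_ofReal, hρ1, one_mul]
    calc edist (w j) y ≤ _ := edist_triangle _ _ _
      _ < η / 2 + η / 2 := ENNReal.add_lt_add_of_le_of_lt
          (edist_ne_top _ _) hd hy'
      _ = η := ENNReal.add_halves η
  have hK : IsCompact (closure (range w)) :=
    htb.closure.isCompact_of_isClosed isClosed_closure
  obtain ⟨v, -, s, hs, hlim⟩ := hK.tendsto_subseq fun j => subset_closure (mem_range_self j)
  exact ⟨v, s, hs, hlim⟩

end Precompactness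

/-! ### Splitting the energies into inner and outer parts -/

section EnergyFormulas

variable {d : ℕ} {ℓ : ℝ} [Fact (0 < ℓ)]

/-- The directional variation in the direction `z / |z|`. -/
def angularVariation (u : Torus d ℓ → ℝ) (z : E d) : ℝ≥0∞ := dirVariation (‖z‖⁻¹ • z) u

/-- The difference quotient `∫ |u(x+z) - u(x)| / |z| dx`. -/
def diffQuotient (u : Torus d ℓ → ℝ) (z : E d) : ℝ≥0∞ := translationDist u (proj ℓ z) / ‖z‖ₑ

/-- The unnormalized part of the limit energy in the unit ball. -/
def innerEnergy (K : ℝ → ℝ≥0) (u : Torus d ℓ → ℝ) : ℝ≥0∞ :=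
  ∫⁻ z in Metric.ball (0 : E d) 1, (K ‖z‖ : ℝ≥0∞) * (angularVariation u z - diffQuotient u z)

/-- The unnormalized part of the limit energy outside the unit ball. -/
def outerEnergy (K : ℝ → ℝ≥0) (u : Torus d ℓ → ℝ) : ℝ≥0∞ :=
  ∫⁻ z in (Metric.ball (0 : E d) 1)ᶜ, (K ‖z‖ : ℝ≥0∞) * diffQuotient u z

/-- The normalization constant of the energies. -/
def energyScale (d : ℕ) (ℓ : ℝ) [Fact (0 < ℓ)] : ℝ≥0∞ :=
  (2 * volume (univ : Set (Torus d ℓ)))⁻¹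

theorem volume_univ_ne_zero : volume (univ : Set (Torus d ℓ)) ≠ 0 :=
  (isOpen_univ.measure_pos volume univ_nonempty).ne'

theorem energyScale_ne_top : energyScale d ℓ ≠ ∞ :=
  ENNReal.inv_ne_top.2 (mul_ne_zero two_ne_zero volume_univ_ne_zero)

theorem energyScale_ne_zero : energyScale d ℓ ≠ 0 :=
  ENNReal.inv_ne_zero.2 (ENNReal.mul_ne_top ENNReal.ofNat_ne_top (measure_ne_top _ _))

theorem translationDist_congr {u v : Torus d ℓ → ℝ} (h : u =ᵐ[volume] v) :
    translationDist u = translationDist v := by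
  funext a
  refine lintegral_congr_ae ?_
  filter_upwards [h, (quasiMeasurePreserving_add_right volume a).ae h] with x h1 h2
  rw [h1, h2]

section Binary

variable {w : L1 d ℓ}

theorem integrable_coe (w : L1 d ℓ) : Integrable w := L1.integrable_coeFn w

theorem measurable_angularVariation (w : L1 d ℓ) : Measurable (angularVariation (w : Torus d ℓ → ℝ)) :=
  (measurable_dirVariation (integrable_coe w)).comp (by fun_prop)

theorem measurable_diffQuotient (h : ∀ᵐ x, w x = 0 ∨ w x = 1) :
    Measurable (diffQuotient (w : Torus d ℓ → ℝ)) := by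
  obtain ⟨u, hu, hwu, -⟩ := exists_unitBounded_rep h
  have h1 : Measurable (translationDist (w : Torus d ℓ → ℝ)) := by
    rw [translationDist_congr hwu]
    exact measurable_translationDist hu.measurable
  exact (h1.comp measurable_proj).div measurable_enorm

theorem translationDist_le_volume (h : ∀ᵐ x, w x = 0 ∨ w x = 1) (a : Torus d ℓ) :
    translationDist (w : Torus d ℓ → ℝ) a ≤ volume (univ : Set (Torus d ℓ)) := by
  obtain ⟨u, -, hwu, hu⟩ := exists_unitBounded_rep h
  rw [translationDist_congr hwu, ← setLIntegral_one, setLIntegral_univ]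
  refine lintegral_mono fun x => ?_
  rcases hu (x + a) with h1 | h1 <;> rcases hu x with h2 | h2 <;> simp [h1, h2]

theorem diffQuotient_le_volume_div (h : ∀ᵐ x, w x = 0 ∨ w x = 1) (z : E d) :
    diffQuotient (w : Torus d ℓ → ℝ) z ≤ volume (univ : Set (Torus d ℓ)) / ‖z‖ₑ := by
  unfold diffQuotient
  gcongr
  exact translationDist_le_volume h _

theorem diffQuotient_ne_top (h : ∀ᵐ x, w x = 0 ∨ w x = 1) (z : E d) :
    diffQuotient (w : Torus d ℓ → ℝ) z ≠ ∞ := by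
  -- At the origin the quotient is $0/0$, which is 0 in `ℝ≥0∞`.
  rcases eq_or_ne z 0 with rfl | hz
  · simp [diffQuotient, translationDist]
  · exact ENNReal.div_ne_top ((translationDist_le_volume h _).trans_lt (measure_lt_top _ _)).ne
      (by simpa using hz)

/-- This makes the inner integrand a genuine difference, so the truncated subtraction in
`innerEnergy` loses nothing. -/
theorem diffQuotient_le_angularVariation (h : ∀ᵐ x, w x = 0 ∨ w x = 1) (z : E d) :
    diffQuotient (w : Torus d ℓ → ℝ) z ≤ angularVariation (w : Torus d ℓ → ℝ) z := by
  rcases eq_or_ne z 0 with rfl | hz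
  · simp [diffQuotient, translationDist]
  obtain ⟨u, hu, hwu, -⟩ := exists_unitBounded_rep h
  have hz' : 0 < ‖z‖ := norm_pos_iff.2 hz
  have h1 := translationDist_le_dirVariation hu z
  rw [diffQuotient, angularVariation, dirVariation_smul (inv_nonneg.2 hz'.le),
    translationDist_congr hwu, dirVariation_congr hwu, ENNReal.ofReal_inv_of_pos hz', ofReal_norm,
    mul_comm, ← div_eq_mul_inv]
  gcongr

theorem angularVariation_le (h : ∀ᵐ x, w x = 0 ∨ w x = 1) (z : E d) :
    angularVariation (w : Torus d ℓ → ℝ) z ≤ totalVariation (w : Torus d ℓ → ℝ) := by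
  obtain ⟨u, hu, hwu, -⟩ := exists_unitBounded_rep h
  rw [angularVariation, dirVariation_congr hwu, totalVariation_congr hwu]
  refine (dirVariation_le hu _).trans (mul_le_of_le_one_left' ?_)
  rw [← ofReal_norm, norm_smul, norm_inv, norm_norm]
  exact ENNReal.ofReal_le_one.2 (inv_mul_le_one_of_le₀ le_rfl (norm_nonneg _))

theorem angularVariation_ne_top (h : IsBV01 w) (z : E d) :
    angularVariation (w : Torus d ℓ → ℝ) z ≠ ∞ :=
  ((angularVariation_le h.1 z).trans_lt h.2).ne

theorem radialMass_indicator {k : ℝ → ℝ≥0∞} {s : Set ℝ} (hs : MeasurableSet s) :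
    radialMass d (s.indicator k) = 2 * volume (Metric.ball (0 : E (d - 1)) 1)
      * ∫⁻ r in Ioi 0 ∩ s, k r * ENNReal.ofReal (r ^ (d - 1)) := by
  rw [radialMass, inter_comm, ← setLIntegral_indicator hs]
  congr 2
  ext r
  by_cases hr : r ∈ s <;> simp [hr]

theorem radialMass_indicator_Iio_one (K : ℝ → ℝ≥0) :
    radialMass d ((Iio 1).indicator fun r => (K r : ℝ≥0∞)) = 2 * kernelMass d K := by
  rw [radialMass_indicator measurableSet_Iio, Ioi_inter_Iio, kernelMass, mul_assoc]

/-- The averaging identity for a truncated kernel: $s=(-\infty,1)$ yields the local term of the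
energy, and $s=(\delta,1)$ the coercivity estimate. -/
theorem setLIntegral_mul_angularVariation [NeZero d] (h : ∀ᵐ x, w x = 0 ∨ w x = 1)
    {k : ℝ → ℝ≥0∞} (hk : Measurable k) {s : Set ℝ} (hs : MeasurableSet s)
    (hks : radialMass d (s.indicator k) ≠ ∞) :
    ∫⁻ z in {z : E d | ‖z‖ ∈ s}, k ‖z‖ * angularVariation (w : Torus d ℓ → ℝ) z
      = radialMass d (s.indicator k) * totalVariation (w : Torus d ℓ → ℝ) := by
  obtain ⟨u, hu, hwu, -⟩ := exists_unitBounded_rep h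
  rw [totalVariation_congr hwu, ← lintegral_radial_mul_dirVariation (hk.indicator hs) hks hu,
    ← lintegral_indicator (show MeasurableSet {z : E d | ‖z‖ ∈ s} from measurable_norm hs)]
  refine lintegral_congr fun z => ?_
  by_cases hz : ‖z‖ ∈ s <;> simp [hz, indicator, angularVariation, dirVariation_congr hwu]

/-- Serves to cancel the difference quotients inside the ball. Only the common term must be finite:
if both remaining terms are infinite, the two sides are the same $\infty-\infty$. -/
theorem coe_add_sub_coe_add {x y b : ℝ≥0∞} (hb : b ≠ ∞) :
    ((x + b : ℝ≥0∞) : EReal) - ((b + y : ℝ≥0∞) : EReal) = (x : EReal) - (y : EReal) := by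
  lift b to ℝ≥0 using hb
  induction x with
  | top => induction y with
    | top => simp
    | coe y => simp [← ENNReal.coe_add]
  | coe x => induction y with
    | top => simp
    | coe y =>
      simp only [← ENNReal.coe_add, EReal.coe_nnreal_eq_coe_real,
        NNReal.coe_add, ← EReal.coe_sub]
      congr 1
      ring

theorem setLIntegral_mul_diffQuotient_add (h : IsBV01 w) {k : E d → ℝ≥0∞} (hk : Measurable k)
    (s : Set (E d)) :
    (∫⁻ z in s, k z * (angularVariation (w : Torus d ℓ → ℝ) z - diffQuotient w z))
      + ∫⁻ z in s, k z * diffQuotient (w : Torus d ℓ → ℝ) z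
      = ∫⁻ z in s, k z * angularVariation (w : Torus d ℓ → ℝ) z := by
  rw [← lintegral_add_right _ (show Measurable fun z => k z * diffQuotient w z from
    hk.mul (measurable_diffQuotient h.1))]
  refine lintegral_congr fun z => ?_
  rw [← mul_add, tsub_add_cancel_of_le (diffQuotient_le_angularVariation h.1 z)]

theorem nonlocalPerimeter_eq (K : ℝ → ℝ≥0) (w : L1 d ℓ) :
    nonlocalPerimeter K (w : Torus d ℓ → ℝ) = energyScale d ℓ *
      ((∫⁻ z in Metric.ball (0 : E d) 1, (K ‖z‖ : ℝ≥0∞) * diffQuotient (w : Torus d ℓ → ℝ) z)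
        + outerEnergy K (w : Torus d ℓ → ℝ)) := by
  rw [outerEnergy, lintegral_add_compl _ measurableSet_ball,
    ← lintegral_const_mul' _ _ energyScale_ne_top, nonlocalPerimeter]
  refine lintegral_congr fun z => ?_
  have hm : AEMeasurable fun x => ‖(w : Torus d ℓ → ℝ) (x + proj ℓ z) - w x‖ₑ :=
    (((integrable_coe w).comp_add_right _).sub (integrable_coe w)).1.enorm
  rw [laverage_eq]
  simp_rw [div_eq_mul_inv]
  rw [lintegral_mul_const'' _ hm, diffQuotient, translationDist, energyScale, div_eq_mul_inv,
    ENNReal.mul_inv (by simp) (by simp), ENNReal.mul_inv (by simp) (by simp)]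
  ring

/-- The local term is the integral of the angular variation over the ball. The difference quotients
there are dominated by it, hence have a finite integral and may be cancelled. -/
theorem energy_eq [NeZero d] {K : ℝ → ℝ≥0} (hK : Measurable K) (hK' : kernelMass d K ≠ ∞)
    (h : IsBV01 w) :
    energy K w = ((energyScale d ℓ * innerEnergy K (w : Torus d ℓ → ℝ) : ℝ≥0∞) : EReal)
      - ((energyScale d ℓ * outerEnergy K (w : Torus d ℓ → ℝ) : ℝ≥0∞) : EReal) := by
  have hKm : Measurable fun z : E d => (K ‖z‖ : ℝ≥0∞) :=
    (hK.comp measurable_norm).coe_nnreal_ennreal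
  have h1 := setLIntegral_mul_angularVariation h.1 (k := fun r => (K r : ℝ≥0∞))
    hK.coe_nnreal_ennreal (measurableSet_Iio (a := (1 : ℝ)))
    (by rw [radialMass_indicator_Iio_one]; exact ENNReal.mul_ne_top ENNReal.ofNat_ne_top hK')
  have hball : {z : E d | ‖z‖ ∈ Iio (1 : ℝ)} = Metric.ball 0 1 := by ext; simp
  rw [radialMass_indicator_Iio_one, hball] at h1
  have h2 := setLIntegral_mul_diffQuotient_add h hKm (Metric.ball 0 1)
  rw [h1] at h2
  have hfin : ∫⁻ z in Metric.ball (0 : E d) 1,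
      (K ‖z‖ : ℝ≥0∞) * diffQuotient (w : Torus d ℓ → ℝ) z ≠ ∞ := by
    refine ne_top_of_le_ne_top ?_ (h2 ▸ le_add_self)
    exact ENNReal.mul_ne_top (ENNReal.mul_ne_top ENNReal.ofNat_ne_top hK') h.2.ne
  have h3 : kernelMass d K * (totalVariation (w : Torus d ℓ → ℝ)
      / volume (univ : Set (Torus d ℓ)))
      = energyScale d ℓ * (2 * kernelMass d K * totalVariation (w : Torus d ℓ → ℝ)) := by
    rw [energyScale, ENNReal.mul_inv (by simp) (by simp), div_eq_mul_inv]
    calc _ = 2⁻¹ * 2 * (kernelMass d K * (totalVariation (w : Torus d ℓ → ℝ)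
          * (volume (univ : Set (Torus d ℓ)))⁻¹)) := by
          rw [ENNReal.inv_mul_cancel (by simp) (by simp), one_mul]
      _ = _ := by ring
  rw [energy, if_pos h, h3, ← h2, nonlocalPerimeter_eq, mul_add, mul_add,
    coe_add_sub_coe_add (ENNReal.mul_ne_top energyScale_ne_top hfin)]
  rfl

theorem limitDensity_eq (K : ℝ → ℝ≥0) (w : L1 d ℓ) (z : E d) :
    limitDensity K (w : Torus d ℓ → ℝ) z = (energyScale d ℓ).toReal * ((K ‖z‖ : ℝ) *
      ((Metric.ball (0 : E d) 1).indicator (fun z => (angularVariation w z).toReal) z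
        - (diffQuotient (w : Torus d ℓ → ℝ) z).toReal)) := by
  have hm : Integrable fun x => (w : Torus d ℓ → ℝ) (x + proj ℓ z) - w x :=
    ((integrable_coe w).comp_add_right _).sub (integrable_coe w)
  have h1 : ∫ x, |(w : Torus d ℓ → ℝ) (x + proj ℓ z) - w x| / ‖z‖
      = (diffQuotient (w : Torus d ℓ → ℝ) z).toReal := by
    rw [integral_div, diffQuotient, ENNReal.toReal_div, toReal_enorm, translationDist,
      ← integral_norm_eq_lintegral_enorm hm.1]
    rfl
  rw [limitDensity, average_eq, h1, energyScale, ENNReal.toReal_inv, ENNReal.toReal_mul]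
  have h2 : (volume (univ : Set (Torus d ℓ))).toReal = volume.real (univ : Set (Torus d ℓ)) := rfl
  rw [h2]
  by_cases hz : z ∈ Metric.ball (0 : E d) 1
  · simp only [indicator_of_mem hz, angularVariation, ENNReal.toReal_ofNat, smul_eq_mul]
    ring
  · simp only [indicator_of_notMem hz, ENNReal.toReal_ofNat, smul_eq_mul]
    ring

/-- The density is nonnegative in the ball and nonpositive outside, so its positive and negative
parts are exactly the inner and outer integrands. -/
theorem limitEnergy_eq (K : ℝ → ℝ≥0) (h : IsBV01 w) :
    limitEnergy K w = ((energyScale d ℓ * innerEnergy K (w : Torus d ℓ → ℝ) : ℝ≥0∞) : EReal)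
      - ((energyScale d ℓ * outerEnergy K (w : Torus d ℓ → ℝ) : ℝ≥0∞) : EReal) := by
  have hle : ∀ z, (diffQuotient (w : Torus d ℓ → ℝ) z).toReal
      ≤ (angularVariation (w : Torus d ℓ → ℝ) z).toReal := fun z =>
    ENNReal.toReal_mono (angularVariation_ne_top h z) (diffQuotient_le_angularVariation h.1 z)
  rw [limitEnergy, if_pos h, extIntegral]
  congr 2
  · rw [innerEnergy, ← lintegral_const_mul' _ _ energyScale_ne_top,
      ← lintegral_indicator measurableSet_ball]
    refine lintegral_congr fun z => ?_
    rw [limitDensity_eq, ENNReal.ofReal_mul ENNReal.toReal_nonneg,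
      ENNReal.ofReal_toReal energyScale_ne_top, ENNReal.ofReal_mul (NNReal.coe_nonneg _),
      ENNReal.ofReal_coe_nnreal]
    by_cases hz : z ∈ Metric.ball (0 : E d) 1
    · rw [indicator_of_mem hz, indicator_of_mem hz, ENNReal.ofReal_sub _ ENNReal.toReal_nonneg,
        ENNReal.ofReal_toReal (angularVariation_ne_top h z),
        ENNReal.ofReal_toReal (diffQuotient_ne_top h.1 z)]
    · rw [indicator_of_notMem hz, indicator_of_notMem hz, zero_sub,
        ENNReal.ofReal_of_nonpos (neg_nonpos.2 ENNReal.toReal_nonneg), mul_zero, mul_zero]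
  · rw [outerEnergy, ← lintegral_const_mul' _ _ energyScale_ne_top,
      ← lintegral_indicator measurableSet_ball.compl]
    refine lintegral_congr fun z => ?_
    rw [limitDensity_eq, ← mul_neg, ← mul_neg, neg_sub, ENNReal.ofReal_mul ENNReal.toReal_nonneg,
      ENNReal.ofReal_toReal energyScale_ne_top, ENNReal.ofReal_mul (NNReal.coe_nonneg _),
      ENNReal.ofReal_coe_nnreal]
    by_cases hz : z ∈ Metric.ball (0 : E d) 1
    · rw [indicator_of_mem hz, indicator_of_notMem (notMem_compl_iff.2 hz),
        ENNReal.ofReal_of_nonpos (sub_nonpos.2 (hle z)), mul_zero, mul_zero]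
    · rw [indicator_of_notMem hz, indicator_of_mem (mem_compl hz), sub_zero,
        ENNReal.ofReal_toReal (diffQuotient_ne_top h.1 z)]

end Binary

end EnergyFormulas

/-! ### Kernel estimates away from the origin and coercivity -/

section Kernels

variable {d : ℕ} {ℓ : ℝ}

/-- A sequence of integrable kernels below the singular kernel `K₀`, converging to it. -/
structure KernelApprox (d : ℕ) (K : ℕ → ℝ → ℝ≥0) (K₀ : ℝ → ℝ≥0) : Prop where
  measurable : ∀ j, Measurable (K j)
  measurable_limit : Measurable K₀
  kernelMass_ne_top : ∀ j, kernelMass d (K j) ≠ ∞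
  le : ∀ j r, 0 < r → K j r ≤ K₀ r
  tendsto : ∀ r, 0 < r → Tendsto (fun j => K j r) atTop (𝓝 (K₀ r))
  singular : ∫⁻ r in Ioo (0 : ℝ) 1, (K₀ r : ℝ≥0∞) * ENNReal.ofReal (r ^ (d - 1)) = ∞
  tail : ∀ δ : ℝ, 0 < δ → ∫⁻ r in Ioi δ, (K₀ r : ℝ≥0∞) *
    ENNReal.ofReal (min (r ^ ((d : ℤ) - 2)) (r ^ ((d : ℤ) - 1))) < ∞

/-- The mass `radialMass` of the part of a kernel in the interval `(δ, 1)`. -/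
def annulusMass (d : ℕ) (K : ℝ → ℝ≥0) (δ : ℝ) : ℝ≥0∞ :=
  radialMass d ((Ioo δ 1).indicator fun r => (K r : ℝ≥0∞))

theorem annulusMass_eq (K : ℝ → ℝ≥0) {δ : ℝ} (hδ : 0 ≤ δ) :
    annulusMass d K δ = 2 * volume (Metric.ball (0 : E (d - 1)) 1)
      * ∫⁻ r in Ioo δ 1, (K r : ℝ≥0∞) * ENNReal.ofReal (r ^ (d - 1)) := by
  rw [annulusMass, radialMass_indicator measurableSet_Ioo,
    inter_eq_right.2 (show Ioo δ 1 ⊆ Ioi 0 from fun r hr => hδ.trans_lt hr.1)]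

theorem two_mul_volume_ball_ne_top (n : ℕ) : 2 * volume (Metric.ball (0 : E n) 1) ≠ ∞ :=
  ENNReal.mul_ne_top ENNReal.ofNat_ne_top measure_ball_lt_top.ne

theorem two_mul_volume_ball_ne_zero (n : ℕ) : 2 * volume (Metric.ball (0 : E n) 1) ≠ 0 :=
  mul_ne_zero two_ne_zero (Metric.measure_ball_pos _ _ one_pos).ne'

theorem pow_sub_one_eq_zpow (hd : 1 ≤ d) (r : ℝ) : r ^ (d - 1) = r ^ ((d : ℤ) - 1) := by
  rw [← zpow_natCast, Nat.cast_sub hd, Nat.cast_one]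

theorem zpow_sub_two_mul (d : ℕ) {r : ℝ} (hr : 0 < r) :
    r ^ ((d : ℤ) - 2) * r = r ^ ((d : ℤ) - 1) := by
  rw [← zpow_add_one₀ hr.ne']
  congr 1
  ring

/-- The quotient is $r^{d-2}$. If the minimum is instead $r^{d-1}$, the missing factor $r$ is
bounded below by `δ`. -/
theorem pow_sub_one_div_le [NeZero d] {δ r : ℝ} (hδ : 0 < δ) (hr : δ < r) :
    r ^ (d - 1) / r ≤ max 1 δ⁻¹ * min (r ^ ((d : ℤ) - 2)) (r ^ ((d : ℤ) - 1)) := by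
  have hr0 : 0 < r := hδ.trans hr
  rw [pow_sub_one_eq_zpow NeZero.one_le, ← zpow_sub_two_mul d hr0,
    mul_div_cancel_right₀ _ hr0.ne']
  have hq : 0 < r ^ ((d : ℤ) - 2) := by positivity
  rcases min_choice (r ^ ((d : ℤ) - 2)) (r ^ ((d : ℤ) - 2) * r) with h | h <;> rw [h]
  · exact le_mul_of_one_le_left hq.le (le_max_left _ _)
  · calc r ^ ((d : ℤ) - 2) = δ⁻¹ * (r ^ ((d : ℤ) - 2) * δ) := by field_simp
      _ ≤ max 1 δ⁻¹ * (r ^ ((d : ℤ) - 2) * r) := by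
        gcongr
        exact le_max_right _ _

namespace KernelApprox

variable {K : ℕ → ℝ → ℝ≥0} {K₀ : ℝ → ℝ≥0}

theorem comp (h : KernelApprox d K K₀) {s : ℕ → ℕ} (hs : Tendsto s atTop atTop) :
    KernelApprox d (fun j => K (s j)) K₀ where
  measurable _ := h.measurable _
  measurable_limit := h.measurable_limit
  kernelMass_ne_top _ := h.kernelMass_ne_top _
  le _ := h.le _
  tendsto r hr := (h.tendsto r hr).comp hs
  singular := h.singular
  tail := h.tail

/-- Up to the volume of the torus, this integrand dominates every difference quotient of a binary
function weighted by a kernel below `K₀`. -/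
theorem lintegral_tail_ne_top [NeZero d] (h : KernelApprox d K K₀) {δ : ℝ} (hδ : 0 < δ) :
    ∫⁻ z in {z : E d | δ < ‖z‖}, (K₀ ‖z‖ : ℝ≥0∞) / ‖z‖ₑ ≠ ∞ := by
  have hm : Measurable ((Ioi δ).indicator fun r : ℝ => (K₀ r : ℝ≥0∞) / ‖r‖ₑ) :=
    (h.measurable_limit.coe_nnreal_ennreal.div measurable_enorm).indicator measurableSet_Ioi
  have h1 := lintegral_polar (d := d) hm (h := fun _ => 1) measurable_const
  have h2 : ∫⁻ z in {z : E d | δ < ‖z‖}, (K₀ ‖z‖ : ℝ≥0∞) / ‖z‖ₑ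
      = ∫⁻ z : E d, (Ioi δ).indicator (fun r : ℝ => (K₀ r : ℝ≥0∞) / ‖r‖ₑ) ‖z‖ * 1 := by
    rw [← lintegral_indicator (measurableSet_lt measurable_const measurable_norm)]
    refine lintegral_congr fun z => ?_
    by_cases hz : δ < ‖z‖ <;> simp [hz, indicator]
  rw [h2, h1]
  refine ENNReal.mul_ne_top 
    (by rw [lintegral_const]; exact ENNReal.mul_ne_top ENNReal.one_ne_top (measure_ne_top _ _)) ?_
  have h3 : ∫⁻ r in Ioi (0 : ℝ), (Ioi δ).indicator (fun r : ℝ => (K₀ r : ℝ≥0∞) / ‖r‖ₑ) r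
      * ENNReal.ofReal (r ^ (d - 1)) ≤ ENNReal.ofReal (max 1 δ⁻¹) *
        ∫⁻ r in Ioi δ, (K₀ r : ℝ≥0∞) *
          ENNReal.ofReal (min (r ^ ((d : ℤ) - 2)) (r ^ ((d : ℤ) - 1))) := by
    rw [← lintegral_const_mul' _ _ ENNReal.ofReal_ne_top]
    refine (setLIntegral_le_lintegral (Ioi 0) _).trans ?_
    rw [← lintegral_indicator (measurableSet_Ioi (a := δ))]
    refine lintegral_mono fun r => ?_
    by_cases hr : r ∈ Ioi δ
    · have hr0 : 0 < r := hδ.trans hr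
      rw [indicator_of_mem hr, indicator_of_mem hr, Real.enorm_of_nonneg hr0.le]
      calc (K₀ r : ℝ≥0∞) / ENNReal.ofReal r * ENNReal.ofReal (r ^ (d - 1))
          = K₀ r * ENNReal.ofReal (r ^ (d - 1) / r) := by
            rw [ENNReal.ofReal_div_of_pos hr0]
            simp only [div_eq_mul_inv]
            ring
        _ ≤ K₀ r * ENNReal.ofReal (max 1 δ⁻¹ *
              min (r ^ ((d : ℤ) - 2)) (r ^ ((d : ℤ) - 1))) := by
            gcongr
            exact pow_sub_one_div_le hδ hr
        _ = _ := by
            rw [ENNReal.ofReal_mul (by positivity)]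
            ring
    · simp [indicator_of_notMem hr]
  exact (h3.trans_lt (ENNReal.mul_lt_top ENNReal.ofReal_lt_top (h.tail δ hδ))).ne

theorem lintegral_annulus_ne_top [NeZero d] (h : KernelApprox d K K₀) {δ : ℝ} (hδ : 0 < δ) :
    ∫⁻ r in Ioo δ 1, (K₀ r : ℝ≥0∞) * ENNReal.ofReal (r ^ (d - 1)) ≠ ∞ := by
  refine ne_top_of_le_ne_top (h.tail δ hδ).ne ?_
  refine (setLIntegral_mono' measurableSet_Ioo fun r hr => ?_).trans
    (lintegral_mono_set Ioo_subset_Ioi_self)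
  have hr0 : 0 < r := hδ.trans hr.1
  gcongr
  rw [pow_sub_one_eq_zpow NeZero.one_le]
  refine le_min ?_ le_rfl
  rw [← zpow_sub_two_mul d hr0]
  exact mul_le_of_le_one_right (by positivity) hr.2.le

theorem annulusMass_limit_ne_top [NeZero d] (h : KernelApprox d K K₀) {δ : ℝ} (hδ : 0 < δ) :
    annulusMass d K₀ δ ≠ ∞ := by
  rw [annulusMass_eq _ hδ.le]
  exact ENNReal.mul_ne_top (two_mul_volume_ball_ne_top _) (h.lintegral_annulus_ne_top hδ)

theorem tendsto_annulusMass [NeZero d] (h : KernelApprox d K K₀) {δ : ℝ} (hδ : 0 < δ) :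
    Tendsto (fun j => annulusMass d (K j) δ) atTop (𝓝 (annulusMass d K₀ δ)) := by
  simp_rw [annulusMass_eq _ hδ.le]
  refine ENNReal.Tendsto.const_mul ?_ (Or.inr (two_mul_volume_ball_ne_top _))
  refine tendsto_lintegral_of_dominated_convergence _
    (fun j => (h.measurable j).coe_nnreal_ennreal.mul (by fun_prop)) (fun j => ?_)
    (h.lintegral_annulus_ne_top hδ) ?_
  · filter_upwards [ae_restrict_mem measurableSet_Ioo] with r hr
    gcongr
    exact_mod_cast h.le j r (hδ.trans hr.1)
  · filter_upwards [ae_restrict_mem measurableSet_Ioo] with r hr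
    exact ENNReal.Tendsto.mul_const (ENNReal.tendsto_coe.2 (h.tendsto r (hδ.trans hr.1)))
      (Or.inr ENNReal.ofReal_ne_top)

/-- The annuli exhaust the punctured ball, on which the mass of `K₀` is infinite; continuity from
below of the weighted measure gives the claim. -/
theorem exists_lt_annulusMass (h : KernelApprox d K K₀) {M : ℝ≥0∞} (hM : M ≠ ∞) :
    ∃ δ : ℝ, 0 < δ ∧ M < annulusMass d K₀ δ := by
  let ν : Measure ℝ := volume.withDensity fun r =>
    (K₀ r : ℝ≥0∞) * ENNReal.ofReal (r ^ (d - 1))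
  have hν : ∀ δ, ν (Ioo δ 1) = ∫⁻ r in Ioo δ 1, (K₀ r : ℝ≥0∞) * ENNReal.ofReal (r ^ (d - 1)) :=
    fun δ => withDensity_apply _ measurableSet_Ioo
  have hmono : Monotone fun n : ℕ => Ioo (1 / ((n : ℝ) + 1)) 1 := fun m n hmn =>
    Ioo_subset_Ioo_left (by gcongr)
  have hU : ⋃ n : ℕ, Ioo (1 / ((n : ℝ) + 1)) 1 = Ioo 0 1 := by
    ext r
    simp only [mem_iUnion, mem_Ioo]
    constructor
    · rintro ⟨n, h1, h2⟩
      exact ⟨lt_trans (by positivity) h1, h2⟩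
    · rintro ⟨h1, h2⟩
      obtain ⟨n, hn⟩ := exists_nat_one_div_lt h1
      exact ⟨n, hn, h2⟩
  have h1 := tendsto_measure_iUnion_atTop (μ := ν) hmono
  rw [hU, hν, h.singular] at h1
  have h2 : Tendsto (fun n : ℕ => annulusMass d K₀ (1 / ((n : ℝ) + 1))) atTop (𝓝 ∞) := by
    have h3 := ENNReal.Tendsto.const_mul (a := 2 * volume (Metric.ball (0 : E (d - 1)) 1)) h1
      (Or.inl ENNReal.top_ne_zero)
    rw [ENNReal.mul_top (two_mul_volume_ball_ne_zero _)] at h3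
    refine h3.congr fun n => ?_
    rw [annulusMass_eq _ (by positivity), Function.comp_apply, hν]
  obtain ⟨n, hn⟩ := (h2.eventually (lt_mem_nhds hM.lt_top)).exists
  exact ⟨_, by positivity, hn⟩

variable [Fact (0 < ℓ)]

/-- The coercivity estimate: on the annulus, split the angular variation into its excess over the
difference quotient and that quotient. The excess is nonnegative, so enlarging its domain to the
ball only increases it. -/
theorem annulusMass_mul_totalVariation_le [NeZero d] (h : KernelApprox d K K₀) (j : ℕ) {δ : ℝ} (hδ : 0 < δ)
    {w : L1 d ℓ} (hw : IsBV01 w) :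
    annulusMass d (K j) δ * totalVariation (w : Torus d ℓ → ℝ)
      ≤ innerEnergy (K j) (w : Torus d ℓ → ℝ)
        + ∫⁻ z in {z : E d | ‖z‖ ∈ Ioo δ 1}, (K j ‖z‖ : ℝ≥0∞) * diffQuotient w z := by
  have hfin : annulusMass d (K j) δ ≠ ∞ := by
    refine ne_top_of_le_ne_top (h.annulusMass_limit_ne_top hδ) ?_
    rw [annulusMass_eq _ hδ.le, annulusMass_eq _ hδ.le]
    gcongr 1
    refine setLIntegral_mono' measurableSet_Ioo fun r hr => ?_
    gcongr
    exact_mod_cast h.le j r (hδ.trans hr.1)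
  have hKm : Measurable fun z : E d => (K j ‖z‖ : ℝ≥0∞) :=
    ((h.measurable j).comp measurable_norm).coe_nnreal_ennreal
  rw [annulusMass, ← setLIntegral_mul_angularVariation hw.1
    (h.measurable j).coe_nnreal_ennreal measurableSet_Ioo hfin,
    ← setLIntegral_mul_diffQuotient_add hw hKm]
  gcongr
  refine lintegral_mono_set fun z hz => ?_
  simpa using hz.2

theorem lintegral_annulus_le (h : KernelApprox d K K₀) (j : ℕ) {δ : ℝ} (hδ : 0 < δ)
    {w : L1 d ℓ} (hw : ∀ᵐ x, w x = 0 ∨ w x = 1) :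
    ∫⁻ z in {z : E d | ‖z‖ ∈ Ioo δ 1}, (K j ‖z‖ : ℝ≥0∞) * diffQuotient w z
      ≤ volume (univ : Set (Torus d ℓ)) *
        ∫⁻ z in {z : E d | δ < ‖z‖}, (K₀ ‖z‖ : ℝ≥0∞) / ‖z‖ₑ := by
  rw [← lintegral_const_mul' _ _ (measure_ne_top _ _)]
  refine (setLIntegral_mono' (measurable_norm measurableSet_Ioo) fun z hz => ?_).trans
    (lintegral_mono_set fun z hz => hz.1)
  calc (K j ‖z‖ : ℝ≥0∞) * diffQuotient w z
      ≤ K₀ ‖z‖ * (volume (univ : Set (Torus d ℓ)) / ‖z‖ₑ) := by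
        gcongr
        · exact_mod_cast h.le j _ (hδ.trans hz.1)
        · exact diffQuotient_le_volume_div hw z
    _ = _ := by simp only [div_eq_mul_inv]; ring

/-- Convergence of the kernel-weighted difference quotients away from the origin. -/
theorem tendsto_lintegral_mul_diffQuotient [NeZero d] (h : KernelApprox d K K₀) {w : ℕ → L1 d ℓ} {v : L1 d ℓ}
    (hw : ∀ j, ∀ᵐ x, w j x = 0 ∨ w j x = 1) (hlim : Tendsto w atTop (𝓝 v)) {S : Set (E d)}
    (hS : MeasurableSet S) {δ : ℝ} (hδ : 0 < δ) (hSδ : ∀ z ∈ S, δ < ‖z‖) :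
    Tendsto (fun j => ∫⁻ z in S, (K j ‖z‖ : ℝ≥0∞) * diffQuotient (w j) z) atTop
      (𝓝 (∫⁻ z in S, (K₀ ‖z‖ : ℝ≥0∞) * diffQuotient v z)) := by
  refine tendsto_lintegral_of_dominated_convergence
    (fun z => volume (univ : Set (Torus d ℓ)) * ((K₀ ‖z‖ : ℝ≥0∞) / ‖z‖ₑ)) (fun j => ?_)
    (fun j => ?_) ?_ ?_
  · exact ((h.measurable j).comp measurable_norm).coe_nnreal_ennreal.mul
      (measurable_diffQuotient (hw j))
  · filter_upwards [ae_restrict_mem hS] with z hz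
    calc (K j ‖z‖ : ℝ≥0∞) * diffQuotient (w j) z
        ≤ K₀ ‖z‖ * (volume (univ : Set (Torus d ℓ)) / ‖z‖ₑ) := by
          gcongr
          · exact_mod_cast h.le j _ (hδ.trans (hSδ z hz))
          · exact diffQuotient_le_volume_div (hw j) z
      _ = _ := by simp only [div_eq_mul_inv]; ring
  · rw [lintegral_const_mul' _ _ (measure_ne_top _ _)]
    exact ENNReal.mul_ne_top (measure_ne_top _ _)
      (ne_top_of_le_ne_top (h.lintegral_tail_ne_top hδ) (lintegral_mono_set hSδ))
  · filter_upwards [ae_restrict_mem hS] with z hz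
    have hz0 : 0 < ‖z‖ := hδ.trans (hSδ z hz)
    have h1 := tendsto_translationDist_of_tendsto (integrable_coe v)
      (fun j => integrable_coe (w j)) (tendsto_L1_iff.1 hlim) (proj ℓ z)
    have hne : ‖z‖ₑ ≠ 0 := by simpa using norm_pos_iff.1 hz0
    have h2 : Tendsto (fun j => diffQuotient (w j : Torus d ℓ → ℝ) z) atTop
        (𝓝 (diffQuotient (v : Torus d ℓ → ℝ) z)) :=
      ENNReal.Tendsto.div_const h1 (Or.inr hne)
    refine ENNReal.Tendsto.mul (ENNReal.tendsto_coe.2 (h.tendsto _ hz0)) (Or.inr ?_) h2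
      (Or.inr ENNReal.coe_ne_top)
    exact ne_top_of_le_ne_top (ENNReal.div_ne_top (measure_ne_top volume univ) hne)
      (le_of_tendsto h2 (Eventually.of_forall fun j => diffQuotient_le_volume_div (hw j) z))

end KernelApprox

end Kernels

/-! ### Compactness and the two inequalities of Γ-convergence -/

section Convergence

variable {d : ℕ} {ℓ : ℝ} [Fact (0 < ℓ)]

theorem ae_eq_zero_or_one_of_tendsto {w : ℕ → L1 d ℓ} {v : L1 d ℓ}
    (hw : ∀ j, ∀ᵐ x, w j x = 0 ∨ w j x = 1) (hlim : Tendsto w atTop (𝓝 v)) :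
    ∀ᵐ x, v x = 0 ∨ v x = 1 := by
  obtain ⟨s, -, hs⟩ := (tendstoInMeasure_of_tendsto_Lp hlim).exists_seq_tendsto_ae
  filter_upwards [ae_all_iff.2 hw, hs] with x hx hsx
  have hcl : IsClosed ({0, 1} : Set ℝ) := (Set.toFinite _).isClosed
  simpa using hcl.mem_of_tendsto hsx (Eventually.of_forall fun j => by simpa using hx (s j))

theorem le_toENNReal_add_of_coe_sub_coe_le {a b : ℝ≥0∞} {B : EReal} (hb : b ≠ ∞) (hB : B ≠ ⊤)
    (h : (a : EReal) - b ≤ B) : a ≤ B.toENNReal + b := by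
  have h1 : (a : EReal) ≤ B + b := by
    rwa [EReal.sub_le_iff_le_add (Or.inl (EReal.coe_ennreal_ne_bot _)) (Or.inr ?_)] at h
    rintro rfl
    rw [le_bot_iff, sub_eq_add_neg, EReal.add_eq_bot_iff, EReal.neg_eq_bot_iff] at h
    rcases h with h | h
    · exact EReal.coe_ennreal_ne_bot _ h
    · exact hb (EReal.coe_ennreal_eq_top_iff.1 h)
  have h2 : B ≤ (B.toENNReal : EReal) := by
    rw [EReal.coe_toENNReal_eq_max]; exact le_max_right _ _
  rw [← EReal.coe_ennreal_le_coe_ennreal_iff, EReal.coe_ennreal_add]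
  exact h1.trans (add_le_add_left h2 _)

theorem tsub_le_liminf_tsub {a n : ℝ≥0∞} {u m : ℕ → ℝ≥0∞} (ha : a ≤ liminf u atTop)
    (hm : Tendsto m atTop (𝓝 n)) :
    a - n ≤ liminf (fun j => u j - m j) atTop := by
  refine le_of_forall_lt fun b hb => ?_
  obtain ⟨b', hb, hb'⟩ := exists_between hb
  refine hb.trans_le (le_liminf_of_le (by isBoundedDefault) ?_)
  obtain ⟨c, hc, hc'⟩ := exists_between (lt_tsub_iff_right.1 hb')
  have h1 : Tendsto (fun j => b' + m j) atTop (𝓝 (b' + n)) := tendsto_const_nhds.add hm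
  filter_upwards [eventually_lt_of_lt_liminf (hc'.trans_le ha) (by isBoundedDefault),
    h1.eventually (gt_mem_nhds hc)] with j h2 h3
  exact (lt_tsub_iff_right.2 (h3.trans h2)).le

namespace KernelApprox

variable [NeZero d] {K : ℕ → ℝ → ℝ≥0} {K₀ : ℝ → ℝ≥0}

theorem tendsto_outerEnergy (h : KernelApprox d K K₀) {w : ℕ → L1 d ℓ} {v : L1 d ℓ}
    (hw : ∀ j, ∀ᵐ x, w j x = 0 ∨ w j x = 1) (hlim : Tendsto w atTop (𝓝 v)) :
    Tendsto (fun j => outerEnergy (K j) (w j : Torus d ℓ → ℝ)) atTop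
      (𝓝 (outerEnergy K₀ (v : Torus d ℓ → ℝ))) :=
  h.tendsto_lintegral_mul_diffQuotient hw hlim measurableSet_ball.compl
    (δ := 1 / 2) (by norm_num) fun z hz => by
      have : 1 ≤ ‖z‖ := by simpa using hz
      linarith

theorem outerEnergy_le (h : KernelApprox d K K₀) :
    ∃ T : ℝ≥0∞, T ≠ ∞ ∧ ∀ (j : ℕ) (w : L1 d ℓ), (∀ᵐ x, w x = 0 ∨ w x = 1) →
      outerEnergy (K j) (w : Torus d ℓ → ℝ) ≤ T ∧ outerEnergy K₀ (w : Torus d ℓ → ℝ) ≤ T := by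
  have hsub : ∀ z ∈ (Metric.ball (0 : E d) 1)ᶜ, 1 / 2 < ‖z‖ := fun z hz => by
    have : 1 ≤ ‖z‖ := by simpa using hz
    linarith
  have key : ∀ (k : ℝ → ℝ≥0), (∀ r, 0 < r → k r ≤ K₀ r) → ∀ w : L1 d ℓ,
      (∀ᵐ x, w x = 0 ∨ w x = 1) → outerEnergy k (w : Torus d ℓ → ℝ)
        ≤ volume (univ : Set (Torus d ℓ)) *
          ∫⁻ z in {z : E d | 1 / 2 < ‖z‖}, (K₀ ‖z‖ : ℝ≥0∞) / ‖z‖ₑ := by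
    intro k hk w hw
    rw [← lintegral_const_mul' _ _ (measure_ne_top _ _)]
    refine (setLIntegral_mono' measurableSet_ball.compl fun z hz => ?_).trans
      (lintegral_mono_set hsub)
    calc (k ‖z‖ : ℝ≥0∞) * diffQuotient w z
        ≤ K₀ ‖z‖ * (volume (univ : Set (Torus d ℓ)) / ‖z‖ₑ) := by
          gcongr
          · exact_mod_cast hk _ (lt_trans (by norm_num) (hsub z hz))
          · exact diffQuotient_le_volume_div hw z
      _ = _ := by simp only [div_eq_mul_inv]; ring
  exact ⟨_, ENNReal.mul_ne_top (measure_ne_top _ _) (h.lintegral_tail_ne_top (by norm_num)),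
    fun j w hw => ⟨key _ (h.le j) w hw, key _ (fun _ _ => le_rfl) w hw⟩⟩

/-- Lower semicontinuity of the inner energy along converging kernels and functions. -/
theorem innerEnergy_le_liminf (h : KernelApprox d K K₀) {w : ℕ → L1 d ℓ} {v : L1 d ℓ}
    (hw : ∀ j, ∀ᵐ x, w j x = 0 ∨ w j x = 1) (hlim : Tendsto w atTop (𝓝 v)) :
    innerEnergy K₀ (v : Torus d ℓ → ℝ)
      ≤ liminf (fun j => innerEnergy (K j) (w j : Torus d ℓ → ℝ)) atTop := by
  have hlim' := tendsto_L1_iff.1 hlim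
  have hi := fun j => integrable_coe (w j)
  refine le_trans (lintegral_mono_ae ?_) (lintegral_liminf_le fun j =>
    ((h.measurable j).comp measurable_norm).coe_nnreal_ennreal.mul
      ((measurable_angularVariation (w j)).sub (measurable_diffQuotient (hw j))))
  -- The kernels are only known to converge at positive radii, so the origin is discarded.
  have h0 : ∀ᵐ z : E d, z ≠ 0 := compl_mem_ae_iff.2 (measure_singleton 0)
  filter_upwards [ae_restrict_of_ae h0] with z hz
  have hz0 : 0 < ‖z‖ := norm_pos_iff.2 hz
  have h1 : Tendsto (fun j => diffQuotient (w j : Torus d ℓ → ℝ) z) atTop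
      (𝓝 (diffQuotient (v : Torus d ℓ → ℝ) z)) :=
    ENNReal.Tendsto.div_const (tendsto_translationDist_of_tendsto (integrable_coe v) hi hlim' _)
      (Or.inr (by simpa using hz))
  have h2 := tsub_le_liminf_tsub (dirVariation_le_liminf (‖z‖⁻¹ • z) (integrable_coe v) hi hlim')
    h1
  have h3 := ENNReal.le_liminf_mul (f := atTop) (u := fun j => (K j ‖z‖ : ℝ≥0∞))
    (v := fun j => angularVariation (w j : Torus d ℓ → ℝ) z - diffQuotient (w j) z)
  rw [(ENNReal.tendsto_coe.2 (h.tendsto _ hz0)).liminf_eq] at h3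
  exact (mul_le_mul_right h2 _).trans h3

/-- The only negative contribution, the outer energy, is bounded uniformly over binary functions. -/
theorem innerEnergy_bounded (h : KernelApprox d K K₀) {w : ℕ → L1 d ℓ} (hw : ∀ j, IsBV01 (w j))
    {B : EReal} (hB : B ≠ ⊤) (hE : ∀ j, energy (K j) (w j) ≤ B) :
    ∃ C : ℝ≥0∞, C ≠ ∞ ∧ ∀ j, innerEnergy (K j) (w j : Torus d ℓ → ℝ) ≤ C := by
  obtain ⟨T, hT, hT'⟩ := h.outerEnergy_le (ℓ := ℓ)
  refine ⟨(energyScale d ℓ)⁻¹ * (B.toENNReal + energyScale d ℓ * T), ?_, fun j => ?_⟩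
  · refine ENNReal.mul_ne_top (ENNReal.inv_ne_top.2 energyScale_ne_zero)
      (ENNReal.add_ne_top.2 ⟨?_, ENNReal.mul_ne_top energyScale_ne_top hT⟩)
    rwa [ne_eq, EReal.toENNReal_eq_top_iff]
  · have h1 := hE j
    have h2 := (hT' j (w j) (hw j).1).1
    rw [energy_eq (h.measurable j) (h.kernelMass_ne_top j) (hw j)] at h1
    have h3 := le_toENNReal_add_of_coe_sub_coe_le
      (ENNReal.mul_ne_top energyScale_ne_top (ne_top_of_le_ne_top hT h2)) hB h1
    calc innerEnergy (K j) (w j : Torus d ℓ → ℝ)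
        = (energyScale d ℓ)⁻¹ * (energyScale d ℓ * innerEnergy (K j) (w j : Torus d ℓ → ℝ)) := by
          rw [← mul_assoc, ENNReal.inv_mul_cancel energyScale_ne_zero energyScale_ne_top, one_mul]
      _ ≤ _ := by
          gcongr
          exact h3.trans (by gcongr)

/-- Coercivity on one annulus of positive limiting mass suffices. The masses for `K j` exceed a
fixed `m` only for large `j`, hence the bound is eventual. -/
theorem totalVariation_eventually_le (h : KernelApprox d K K₀) {w : ℕ → L1 d ℓ}
    (hw : ∀ j, IsBV01 (w j)) {C : ℝ≥0∞} (hC : C ≠ ∞)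
    (hwC : ∀ j, innerEnergy (K j) (w j : Torus d ℓ → ℝ) ≤ C) :
    ∃ P : ℝ≥0∞, P ≠ ∞ ∧ ∀ᶠ j in atTop, totalVariation (w j : Torus d ℓ → ℝ) ≤ P := by
  obtain ⟨δ, hδ, hpos⟩ := h.exists_lt_annulusMass ENNReal.zero_ne_top
  obtain ⟨m, hm0, hm⟩ := exists_between hpos
  let Q := volume (univ : Set (Torus d ℓ)) *
    ∫⁻ z in {z : E d | δ < ‖z‖}, (K₀ ‖z‖ : ℝ≥0∞) / ‖z‖ₑ
  have hQ : Q ≠ ∞ := ENNReal.mul_ne_top (measure_ne_top _ _) (h.lintegral_tail_ne_top hδ)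
  refine ⟨(C + Q) / m, ENNReal.div_ne_top (ENNReal.add_ne_top.2 ⟨hC, hQ⟩) hm0.ne', ?_⟩
  filter_upwards [(h.tendsto_annulusMass hδ).eventually (lt_mem_nhds hm)] with j hj
  rw [ENNReal.le_div_iff_mul_le (Or.inl hm0.ne') (Or.inl hm.ne_top), mul_comm]
  calc m * totalVariation (w j : Torus d ℓ → ℝ)
      ≤ annulusMass d (K j) δ * totalVariation (w j : Torus d ℓ → ℝ) := by gcongr
    _ ≤ _ := h.annulusMass_mul_totalVariation_le j hδ (hw j)
    _ ≤ C + Q := add_le_add (hwC j) (h.lintegral_annulus_le j hδ (hw j).1)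

/-- No perimeter is lost because the singularity of `K₀` penalizes a gap $P-V$ by an arbitrarily
large factor, while the energy bound `C` does not depend on the annulus. -/
theorem limit_totalVariation_le (h : KernelApprox d K K₀) {w : ℕ → L1 d ℓ} {v : L1 d ℓ}
    (hw : ∀ j, IsBV01 (w j)) (hv : IsBV01 v) (hlim : Tendsto w atTop (𝓝 v)) {C : ℝ≥0∞}
    (hC : C ≠ ∞) (hwC : ∀ j, innerEnergy (K j) (w j : Torus d ℓ → ℝ) ≤ C) {P : ℝ≥0∞} (hP : P ≠ ∞)
    (hTV : Tendsto (fun j => totalVariation (w j : Torus d ℓ → ℝ)) atTop (𝓝 P)) :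
    P ≤ totalVariation (v : Torus d ℓ → ℝ) := by
  set V := totalVariation (v : Torus d ℓ → ℝ) with hVdef
  by_contra! hlt
  have hgap : P - V ≠ 0 := (tsub_pos_of_lt hlt).ne'
  -- The annulus is chosen so that its mass times the gap exceeds `C`.
  obtain ⟨δ, hδ, hδC⟩ := h.exists_lt_annulusMass (M := C / (P - V)) (ENNReal.div_ne_top hC hgap)
  have hfin := h.annulusMass_limit_ne_top hδ
  have hle : annulusMass d K₀ δ * P ≤ C + annulusMass d K₀ δ * V := by
    have h1 : annulusMass d K₀ δ * P
        ≤ C + ∫⁻ z in {z : E d | ‖z‖ ∈ Ioo δ 1}, (K₀ ‖z‖ : ℝ≥0∞) * diffQuotient v z := by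
      refine le_of_tendsto_of_tendsto'
        (ENNReal.Tendsto.mul (h.tendsto_annulusMass hδ) (Or.inr hP) hTV (Or.inr hfin))
        (tendsto_const_nhds.add (h.tendsto_lintegral_mul_diffQuotient (fun j => (hw j).1) hlim
          (measurable_norm measurableSet_Ioo) hδ fun z hz => hz.1)) fun j => ?_
      exact (h.annulusMass_mul_totalVariation_le j hδ (hw j)).trans (by gcongr; exact hwC j)
    -- In the limit the difference quotients on the annulus are at most the angular variation of
    -- `v`, which integrates to mass times `V`.
    refine h1.trans ?_
    rw [annulusMass, hVdef, ← setLIntegral_mul_angularVariation hv.1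
      h.measurable_limit.coe_nnreal_ennreal measurableSet_Ioo hfin]
    gcongr with z
    exact diffQuotient_le_angularVariation hv.1 z
  have h2 : annulusMass d K₀ δ * (P - V) ≤ C := by
    rw [ENNReal.mul_sub fun _ _ => hfin]
    exact tsub_le_iff_right.2 hle
  rw [ENNReal.div_lt_iff (Or.inl hgap) (Or.inr hC)] at hδC
  exact absurd h2 (not_le.2 hδC)

/-- Compactness of sequences of bounded energy. -/
theorem exists_tendsto_subseq (h : KernelApprox d K K₀) {w : ℕ → L1 d ℓ} (hw : ∀ j, IsBV01 (w j))
    {B : EReal} (hB : B ≠ ⊤) (hE : ∀ j, energy (K j) (w j) ≤ B) :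
    ∃ v : L1 d ℓ, IsBV01 v ∧ ∃ s : ℕ → ℕ, StrictMono s ∧
      Tendsto (fun j => w (s j)) atTop (𝓝 v) ∧
      Tendsto (fun j => totalVariation (w (s j) : Torus d ℓ → ℝ)) atTop
        (𝓝 (totalVariation (v : Torus d ℓ → ℝ))) := by
  obtain ⟨C, hC, hwC⟩ := h.innerEnergy_bounded hw hB hE
  obtain ⟨P, hP, hPe⟩ := h.totalVariation_eventually_le hw hC hwC
  obtain ⟨N, hN⟩ := eventually_atTop.1 hPe
  obtain ⟨v, s₁, hs₁, hlim₁⟩ := exists_tendsto_subseq_of_totalVariation_le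
    (w := fun j => w (j + N)) (fun j => (hw _).1) hP fun j => hN _ (Nat.le_add_left _ _)
  -- A second extraction, in the compact space `ℝ≥0∞`, makes the perimeters converge; the limit is
  -- then identified by semicontinuity and the absence of loss.
  obtain ⟨Q, -, s₂, hs₂, hlim₂⟩ := isCompact_univ.tendsto_subseq
    (x := fun j => totalVariation (w (s₁ j + N) : Torus d ℓ → ℝ)) fun _ => mem_univ _
  replace hlim₂ : Tendsto (fun j => totalVariation (w (s₁ (s₂ j) + N) : Torus d ℓ → ℝ)) atTop
      (𝓝 Q) := hlim₂
  have hs : StrictMono fun j => s₁ (s₂ j) + N := fun i j hij =>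
    Nat.add_lt_add_right (hs₁ (hs₂ hij)) N
  have hlim : Tendsto (fun j => w (s₁ (s₂ j) + N)) atTop (𝓝 v) := hlim₁.comp hs₂.tendsto_atTop
  have hQP : Q ≤ P := le_of_tendsto hlim₂ (Eventually.of_forall fun j =>
    hN _ (Nat.le_add_left _ _))
  have hQ : Q ≠ ∞ := ne_top_of_le_ne_top hP hQP
  have hle : totalVariation (v : Torus d ℓ → ℝ) ≤ Q := by
    have := totalVariation_le_liminf (integrable_coe v) (fun j => integrable_coe _)
      (tendsto_L1_iff.1 hlim)
    rwa [hlim₂.liminf_eq] at this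
  have hv : IsBV01 v :=
    ⟨ae_eq_zero_or_one_of_tendsto (fun j => (hw _).1) hlim, hle.trans_lt hQ.lt_top⟩
  have hge := (h.comp hs.tendsto_atTop).limit_totalVariation_le (fun j => hw _) hv hlim hC
    (fun j => hwC _) hQ hlim₂
  exact ⟨v, hv, _, hs, hlim, le_antisymm hle hge ▸ hlim₂⟩

theorem limitEnergy_le_liminf_of_isBV01 (h : KernelApprox d K K₀) {w : ℕ → L1 d ℓ} {v : L1 d ℓ}
    (hw : ∀ j, IsBV01 (w j)) (hv : IsBV01 v) (hlim : Tendsto w atTop (𝓝 v)) :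
    limitEnergy K₀ v ≤ liminf (fun j => energy (K j) (w j)) atTop := by
  obtain ⟨T, hT, hT'⟩ := h.outerEnergy_le (ℓ := ℓ)
  simp_rw [fun j => energy_eq (h.measurable j) (h.kernelMass_ne_top j) (hw j), limitEnergy_eq _ hv,
    sub_eq_add_neg]
  refine le_trans (add_le_add ?_ ?_) EReal.le_liminf_add
  · have h1 : energyScale d ℓ * innerEnergy K₀ (v : Torus d ℓ → ℝ) ≤ liminf (fun j =>
        energyScale d ℓ * innerEnergy (K j) (w j : Torus d ℓ → ℝ)) atTop := by
      have h2 := ENNReal.le_liminf_mul (f := atTop) (u := fun _ : ℕ => energyScale d ℓ)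
        (v := fun j => innerEnergy (K j) (w j : Torus d ℓ → ℝ))
      rw [liminf_const] at h2
      exact (mul_le_mul_right (h.innerEnergy_le_liminf (fun j => (hw j).1) hlim) _).trans h2
    have h3 : Monotone ((↑) : ℝ≥0∞ → EReal) := fun a b hab =>
      EReal.coe_ennreal_le_coe_ennreal_iff.2 hab
    refine (h3 h1).trans_eq ?_
    exact h3.map_liminf_of_continuousAt _ continuous_coe_ennreal_ereal.continuousAt
  · refine (Tendsto.liminf_eq ?_).ge
    refine (continuous_neg.tendsto _).comp ((continuous_coe_ennreal_ereal.tendsto _).comp ?_)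
    exact ENNReal.Tendsto.const_mul (h.tendsto_outerEnergy (fun j => (hw j).1) hlim)
      (Or.inr energyScale_ne_top)

/-- If the inequality failed, a subsequence would have energy below some finite `c`. It would then
lie in $BV$, and compactness would force the same for `v`, so the $BV$ case applies. -/
theorem limitEnergy_le_liminf (h : KernelApprox d K K₀) {w : ℕ → L1 d ℓ} {v : L1 d ℓ}
    (hlim : Tendsto w atTop (𝓝 v)) :
    limitEnergy K₀ v ≤ liminf (fun j => energy (K j) (w j)) atTop := by
  by_contra! hlt
  obtain ⟨c, hc, hc'⟩ := exists_between hlt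
  obtain ⟨s, hs, hsc⟩ := extraction_of_frequently_atTop
    (frequently_lt_of_liminf_lt (by isBoundedDefault) hc)
  have hctop : c ≠ ⊤ := hc'.ne_top
  have hw : ∀ j, IsBV01 (w (s j)) := fun j => by
    by_contra hn
    have := hsc j
    rw [energy, if_neg hn] at this
    exact not_top_lt this
  have hK := h.comp hs.tendsto_atTop
  have hlim' : Tendsto (fun j => w (s j)) atTop (𝓝 v) := hlim.comp hs.tendsto_atTop
  obtain ⟨v', hv', s', hs', hlim'', -⟩ := hK.exists_tendsto_subseq hw hctop fun j => (hsc j).le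
  obtain rfl : v' = v := tendsto_nhds_unique hlim'' (hlim'.comp hs'.tendsto_atTop)
  have h1 := hK.limitEnergy_le_liminf_of_isBV01 hw hv' hlim'
  refine absurd (h1.trans ?_) (not_le.2 hc')
  exact liminf_le_of_le (by isBoundedDefault) fun b hb => by
    obtain ⟨j, hj⟩ := hb.exists
    exact hj.trans (hsc j).le

theorem limsup_energy_le (h : KernelApprox d K K₀) (v : L1 d ℓ) :
    limsup (fun j => energy (K j) v) atTop ≤ limitEnergy K₀ v := by
  by_cases hv : IsBV01 v
  swap
  · rw [limitEnergy, if_neg hv]; exact le_top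
  obtain ⟨T, hT, hT'⟩ := h.outerEnergy_le (ℓ := ℓ)
  have hlim : Tendsto (fun j => ((energyScale d ℓ * innerEnergy K₀ (v : Torus d ℓ → ℝ) : ℝ≥0∞)
      : EReal) - ((energyScale d ℓ * outerEnergy (K j) (v : Torus d ℓ → ℝ) : ℝ≥0∞) : EReal)) atTop
      (𝓝 (limitEnergy K₀ v)) := by
    rw [limitEnergy_eq _ hv]
    simp_rw [sub_eq_add_neg]
    have h1 : Tendsto (fun j => -((energyScale d ℓ * outerEnergy (K j) (v : Torus d ℓ → ℝ) : ℝ≥0∞)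
        : EReal)) atTop
        (𝓝 (-((energyScale d ℓ * outerEnergy K₀ (v : Torus d ℓ → ℝ) : ℝ≥0∞) : EReal))) :=
      (continuous_neg.tendsto _).comp ((continuous_coe_ennreal_ereal.tendsto _).comp
        (ENNReal.Tendsto.const_mul (h.tendsto_outerEnergy (w := fun _ => v) (fun _ => hv.1)
          tendsto_const_nhds) (Or.inr energyScale_ne_top)))
    -- The limiting outer energy is finite, so $\infty-\infty$ does not occur even when the inner
    -- energy is infinite.
    refine (EReal.continuousAt_add (p := (_, _)) (Or.inr ?_)
      (Or.inl (EReal.coe_ennreal_ne_bot _))).tendsto.comp (tendsto_const_nhds.prodMk_nhds h1)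
    rw [ne_eq, EReal.neg_eq_bot_iff, EReal.coe_ennreal_eq_top_iff]
    exact ENNReal.mul_ne_top energyScale_ne_top (ne_top_of_le_ne_top hT (hT' 0 v hv.1).2)
  rw [← hlim.limsup_eq]
  refine limsup_le_limsup (Eventually.of_forall fun j => ?_)
  dsimp only
  rw [energy_eq (h.measurable j) (h.kernelMass_ne_top j) hv]
  -- Since $K_j\le K_0$ and the inner integrand is nonnegative, the inner energy may be replaced by
  -- its limiting value.
  refine EReal.sub_le_sub (EReal.coe_ennreal_le_coe_ennreal_iff.2 (mul_le_mul_right ?_ _)) le_rfl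
  refine lintegral_mono_ae ?_
  have h0 : ∀ᵐ z : E d, z ≠ 0 := compl_mem_ae_iff.2 (measure_singleton 0)
  filter_upwards [ae_restrict_of_ae h0] with z hz
  gcongr
  exact_mod_cast h.le j _ (norm_pos_iff.2 hz)

theorem gammaConverges (h : KernelApprox d K K₀) :
    GammaConverges (fun j => energy (d := d) (ℓ := ℓ) (K j)) (limitEnergy K₀) :=
  ⟨fun _ _ hlim => h.limitEnergy_le_liminf hlim,
    fun u => ⟨fun _ => u, tendsto_const_nhds, h.limsup_energy_le u⟩⟩

end KernelApprox

end Convergence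

end NonlocalPerimeter

end

/-! ### The theorem -/

open NonlocalPerimeter
theorem theorem1p1
    (d : ℕ) (hd : 1 ≤ d) (ℓ : ℝ) [Fact (0 < ℓ)]
    -- the radial profiles of the kernels, with parameter `ε ∈ (0, ε₀)`
    (ε₀ : ℝ) (hε₀ : 0 < ε₀) (K : ℝ → ℝ → ℝ≥0) (K₀ : ℝ → ℝ≥0)
    (hK_meas : ∀ ε ∈ Ioo 0 ε₀, Measurable (K ε)) (hK₀_meas : Measurable K₀)
    -- `K_ε ∈ L¹(B_1)`
    (hK_int : ∀ ε ∈ Ioo 0 ε₀,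
      ∫⁻ r in Ioo (0 : ℝ) 1, (K ε r : ℝ≥0∞) * ENNReal.ofReal (r ^ (d - 1)) < ∞)
    -- `K_ε ↗ K_0` as `ε ↘ 0`
    (hK_mono : ∀ r : ℝ, 0 < r → AntitoneOn (fun ε => K ε r) (Ioo 0 ε₀))
    (hK_lim : ∀ r : ℝ, 0 < r → Tendsto (fun ε => K ε r) (𝓝[>] 0) (𝓝 (K₀ r)))
    -- singularity at the origin and integrability away from it
    (hK₀_sing : ∫⁻ r in Ioo (0 : ℝ) 1, (K₀ r : ℝ≥0∞) * ENNReal.ofReal (r ^ (d - 1)) = ∞)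
    (hK₀_tail : ∀ δ : ℝ, 0 < δ →
      ∫⁻ r in Ioi δ, (K₀ r : ℝ≥0∞) *
        ENNReal.ofReal (min (r ^ ((d : ℤ) - 2)) (r ^ ((d : ℤ) - 1))) < ∞) :
    -- compactness
    (∀ (ε : ℕ → ℝ), (∀ j, ε j ∈ Ioo 0 ε₀) → Tendsto ε atTop (𝓝 0) →
      ∀ u : ℕ → L1 d ℓ, (∀ j, IsBV01 (u j)) → (⨆ j, energy (K (ε j)) (u j)) < ⊤ →
        ∃ v : L1 d ℓ, IsBV01 v ∧ ∃ s : ℕ → ℕ, StrictMono s ∧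
          Tendsto (fun j => u (s j)) atTop (𝓝 v) ∧
          Tendsto (fun j => totalVariation (u (s j) : Torus d ℓ → ℝ)) atTop
            (𝓝 (totalVariation (v : Torus d ℓ → ℝ)))) ∧
    -- `Γ`-convergence
    (∀ (ε : ℕ → ℝ), (∀ j, ε j ∈ Ioo 0 ε₀) → Tendsto ε atTop (𝓝 0) →
      GammaConverges (fun j => energy (d := d) (ℓ := ℓ) (K (ε j))) (limitEnergy K₀)) := by
  have : NeZero d := ⟨by omega⟩
  have key : ∀ ε : ℕ → ℝ, (∀ j, ε j ∈ Ioo 0 ε₀) → Tendsto ε atTop (𝓝 0) →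
      KernelApprox d (fun j => K (ε j)) K₀ := fun ε hε hε0 =>
    { measurable := fun j => hK_meas _ (hε j)
      measurable_limit := hK₀_meas
      kernelMass_ne_top := fun j => ENNReal.mul_ne_top measure_ball_lt_top.ne (hK_int _ (hε j)).ne
      le := fun j r hr => by
        -- For parameters below `ε j` the kernel is at least `K (ε j)`, and this passes to the limit
        -- `K₀`.
        refine ge_of_tendsto (hK_lim r hr) ?_
        filter_upwards [Ioo_mem_nhdsGT (hε j).1] with t ht
        exact hK_mono r hr ⟨ht.1, ht.2.trans (hε j).2⟩ (hε j) ht.2.le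
      tendsto := fun r hr => (hK_lim r hr).comp
        (tendsto_nhdsWithin_iff.2 ⟨hε0, Eventually.of_forall fun j => (hε j).1⟩)
      singular := hK₀_sing
      tail := hK₀_tail }
  refine ⟨fun ε hε hε0 u hu hE => ?_, fun ε hε hε0 => (key ε hε hε0).gammaConverges⟩
  exact (key ε hε hε0).exists_tendsto_subseq hu hE.ne fun j =>
    le_iSup (fun j => energy (K (ε j)) (u j)) j
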